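/- Let $\mathcal H=L^2(\mathbb R)$, with $(Q\psi)(x)=x\psi(x)$, $P=-i\,d/dx$, $a=\tfrac1{\sqrt2}(Q+iP)$, and let $W(q,p)=e^{iqp/2}e^{-iqP}e^{ipQ}$ be the Weyl operators. For $\theta\in\mathbb R$ let $\mathsf Q_\theta$ be the spectral measure of the quadrature $Q_\theta$, the closure of $\tfrac1{\sqrt2}(e^{i\theta}a^*+e^{-i\theta}a)$ on Schwartz functions, and put $\mathsf Q=\mathsf Q_0$. Let $U$ be the beam splitter on $\mathcal H\otimes\mathcal H=L^2(\mathbb R^2)$, $(U\Psi)(x,y)=\Psi\big(\tfrac1{\sqrt2}(x+y),\tfrac1{\sqrt2}(-x+y)\big)$. A state is a positive operator of trace one; an observable on $\mathbb R^2$ is a normalized positive operator measure on the Borel sets of $\mathbb R^2$. Let $\theta\in\mathbb R$ and let $\sigma$ be a state on $\mathcal H$. There is exactly one observable $\mathsf E_{\theta,\sigma}$ on $\mathbb R^2$ such that $$\operatorname{tr}[\rho\,\mathsf E_{\theta,\sigma}(X\times Y)]=\operatorname{tr}\big[U(\rho\otimes\sigma)U^*\,\mathsf Q(\tfrac1{\sqrt2}X)\otimes\mathsf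 Q_\theta(\tfrac1{\sqrt2}Y)\big]$$ for all states $\rho$ and all Borel sets $X,Y\subseteq\mathbb R$. For all $q,p\in\mathbb R$ and all Borel sets $Z\subseteq\mathbb R^2$ it satisfies $$W(q,p)\,\mathsf E_{\theta,\sigma}(Z)\,W(q,p)^*=\mathsf E_{\theta,\sigma}\big(Z+(q,\;q\cos\theta+p\sin\theta)\big).$$ Moreover $\mathsf E_{\theta,\sigma}$ is covariant, that is, $W(q,p)\mathsf E_{\theta,\sigma}(Z)W(q,p)^*=\mathsf E_{\theta,\sigma}(Z+(q,p))$ for all $q,p\in\mathbb R$ and all Borel $Z\subseteq\mathbb R^2$, if and only if $\theta\equiv\tfrac\pi2\pmod{2\pi}$; in particular, for $\theta\in(-\pi,\pi]$, if and only if $\theta=\tfrac\pi2$. -/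

import Mathlib

open MeasureTheory
open scoped SchwartzMap ENNReal InnerProductSpace TensorProduct

noncomputable section

namespace EightPort

/-! ### The Hilbert spaces (coordinate representation) -/

/-- The Hilbert space of a single mode, `L²(ℝ)`. -/
abbrev H : Type := Lp ℂ 2 (volume : Measure ℝ)

/-- The Hilbert space of two modes, `L²(ℝ) ⊗ L²(ℝ) = L²(ℝ²)`. -/
abbrev H₂ : Type := Lp ℂ 2 (volume : Measure (ℝ × ℝ))

theorem memLp_tprod (f g : H) :
    MemLp (fun z : ℝ × ℝ => f z.1 * g z.2) 2 (volume : Measure (ℝ × ℝ)) := by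
  have hm : AEStronglyMeasurable (fun z : ℝ × ℝ => f z.1 * g z.2)
      (volume : Measure (ℝ × ℝ)) :=
    (Lp.aestronglyMeasurable f).comp_fst.mul (Lp.aestronglyMeasurable g).comp_snd
  rw [memLp_two_iff_integrable_sq_norm hm]
  have hf := (memLp_two_iff_integrable_sq_norm (Lp.aestronglyMeasurable f)).1 (Lp.memLp f)
  have hg := (memLp_two_iff_integrable_sq_norm (Lp.aestronglyMeasurable g)).1 (Lp.memLp g)
  simpa [mul_pow, Measure.volume_eq_prod] using hf.mul_prod hg

/-- The product vector `f ⊗ g`, i.e. the function `(x, y) ↦ f x * g y`. -/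
def tprod (f g : H) : H₂ := (memLp_tprod f g).toLp _

theorem tprod_coeFn (f g : H) :
    tprod f g =ᵐ[(volume : Measure (ℝ × ℝ))] fun z => f z.1 * g z.2 :=
  MemLp.coeFn_toLp _

/-- `(f, g) ↦ f ⊗ g` as a bilinear map. -/
def tprodₗ : H →ₗ[ℂ] H →ₗ[ℂ] H₂ :=
  LinearMap.mk₂ ℂ tprod
    (fun f f' g => by
      have h := (Measure.quasiMeasurePreserving_fst (μ := (volume : Measure ℝ))
        (ν := (volume : Measure ℝ))).ae_eq_comp (Lp.coeFn_add f f')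
      ext1
      filter_upwards [tprod_coeFn (f + f') g, Lp.coeFn_add (tprod f g) (tprod f' g),
        tprod_coeFn f g, tprod_coeFn f' g, h] with z h1 h2 h3 h4 h5
      simp only [Function.comp_apply, Pi.add_apply] at h5
      rw [h1, h2, Pi.add_apply, h3, h4, h5, add_mul])
    (fun c f g => by
      have h := (Measure.quasiMeasurePreserving_fst (μ := (volume : Measure ℝ))
        (ν := (volume : Measure ℝ))).ae_eq_comp (Lp.coeFn_smul c f)
      ext1
      filter_upwards [tprod_coeFn (c • f) g, Lp.coeFn_smul c (tprod f g),
        tprod_coeFn f g, h] with z h1 h2 h3 h5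
      simp only [Function.comp_apply, Pi.smul_apply] at h5
      rw [h1, h2, Pi.smul_apply, h3, h5, smul_mul_assoc])
    (fun f g g' => by
      have h := (Measure.quasiMeasurePreserving_snd (μ := (volume : Measure ℝ))
        (ν := (volume : Measure ℝ))).ae_eq_comp (Lp.coeFn_add g g')
      ext1
      filter_upwards [tprod_coeFn f (g + g'), Lp.coeFn_add (tprod f g) (tprod f g'),
        tprod_coeFn f g, tprod_coeFn f g', h] with z h1 h2 h3 h4 h5
      simp only [Function.comp_apply, Pi.add_apply] at h5
      rw [h1, h2, Pi.add_apply, h3, h4, h5, mul_add])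
    (fun c f g => by
      have h := (Measure.quasiMeasurePreserving_snd (μ := (volume : Measure ℝ))
        (ν := (volume : Measure ℝ))).ae_eq_comp (Lp.coeFn_smul c g)
      ext1
      filter_upwards [tprod_coeFn f (c • g), Lp.coeFn_smul c (tprod f g),
        tprod_coeFn f g, h] with z h1 h2 h3 h5
      simp only [Function.comp_apply, Pi.smul_apply] at h5
      rw [h1, h2, Pi.smul_apply, h3, h5, mul_smul_comm])

/-- The canonical embedding of the algebraic tensor product into `L²(ℝ²)`. -/
def tensorEmb : (H ⊗[ℂ] H) →ₗ[ℂ] H₂ := TensorProduct.lift tprodₗ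

/-- The tensor product `S ⊗ T` of bounded operators: the continuous extension to `L²(ℝ²)` of
`f ⊗ g ↦ S f ⊗ T g`. -/
def tensorOp (S T : H →L[ℂ] H) : H₂ →L[ℂ] H₂ :=
  LinearMap.extendOfNorm
    (tensorEmb ∘ₗ TensorProduct.map (S : H →ₗ[ℂ] H) (T : H →ₗ[ℂ] H)) tensorEmb

theorem inner_tprod (f g f' g' : H) : ⟪tprod f g, tprod f' g'⟫_ℂ = ⟪f, f'⟫_ℂ * ⟪g, g'⟫_ℂ := by
  rw [L2.inner_def, L2.inner_def, L2.inner_def, ← integral_prod_mul, ← Measure.volume_eq_prod]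
  refine integral_congr_ae ?_
  filter_upwards [tprod_coeFn f g, tprod_coeFn f' g'] with z h1 h2
  rw [h1, h2]
  simp only [RCLike.inner_apply, map_mul]
  ring

theorem inner_tensorEmb (x y : H ⊗[ℂ] H) : ⟪tensorEmb x, tensorEmb y⟫_ℂ = ⟪x, y⟫_ℂ := by
  induction x with
  | zero => simp
  | add a b ha hb => rw [map_add, inner_add_left, inner_add_left, ha, hb]
  | tmul f g =>
    induction y with
    | zero => simp
    | add a b ha hb => rw [map_add, inner_add_right, inner_add_right, ha, hb]
    | tmul f' g' => exact inner_tprod f g f' g'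

theorem norm_tensorEmb (x : H ⊗[ℂ] H) : ‖tensorEmb x‖ = ‖x‖ := by
  rw [norm_eq_sqrt_re_inner (𝕜 := ℂ), norm_eq_sqrt_re_inner (𝕜 := ℂ), inner_tensorEmb]

section Bound

variable {K : Type*} [NormedAddCommGroup K] [InnerProductSpace ℂ K] [CompleteSpace K]

theorem inner_tmap (S T : K →L[ℂ] K) (x y : K ⊗[ℂ] K) :
    ⟪TensorProduct.map (S : K →ₗ[ℂ] K) (T : K →ₗ[ℂ] K) x, y⟫_ℂ =
      ⟪x, TensorProduct.map ((ContinuousLinearMap.adjoint S : K →L[ℂ] K) : K →ₗ[ℂ] K)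
        ((ContinuousLinearMap.adjoint T : K →L[ℂ] K) : K →ₗ[ℂ] K) y⟫_ℂ := by
  induction x with
  | zero => simp
  | add a b ha hb => rw [map_add, inner_add_left, inner_add_left, ha, hb]
  | tmul f g =>
    induction y with
    | zero => simp
    | add a b ha hb => rw [map_add, inner_add_right, inner_add_right, ha, hb]
    | tmul f' g' => simp [ContinuousLinearMap.adjoint_inner_right]

theorem exists_star_mul_self_add (S : K →L[ℂ] K) :
    ∃ R : K →L[ℂ] K, star S * S + star R * R = ((‖S‖ ^ 2 : ℝ) : ℂ) • (1 : K →L[ℂ] K) := by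
  have h1 : (0 : K →L[ℂ] K) ≤ algebraMap ℝ _ (‖S‖ ^ 2) - star S * S :=
    sub_nonneg.2 CStarAlgebra.star_mul_le_algebraMap_norm_sq
  obtain ⟨R, hR⟩ := CStarAlgebra.nonneg_iff_eq_star_mul_self.1 h1
  refine ⟨R, ?_⟩
  rw [← hR, Algebra.algebraMap_eq_smul_one, add_sub_cancel]
  ext x
  rw [smul_apply, smul_apply, Complex.coe_smul]

theorem norm_tmap_left (S : K →L[ℂ] K) (x : K ⊗[ℂ] K) :
    ‖TensorProduct.map (S : K →ₗ[ℂ] K) LinearMap.id x‖ ≤ ‖S‖ * ‖x‖ := by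
  obtain ⟨R, h3⟩ := exists_star_mul_self_add S
  have key : ∀ A : K →L[ℂ] K, (‖TensorProduct.map (A : K →ₗ[ℂ] K) LinearMap.id x‖ : ℂ) ^ 2 =
      ⟪x, TensorProduct.map ((star A * A : K →L[ℂ] K) : K →ₗ[ℂ] K) LinearMap.id x⟫_ℂ := by
    intro A
    have h := inner_self_eq_norm_sq_to_K (𝕜 := ℂ)
      (TensorProduct.map (A : K →ₗ[ℂ] K) LinearMap.id x)
    have h2 := inner_tmap A 1 x (TensorProduct.map (A : K →ₗ[ℂ] K) LinearMap.id x)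
    rw [← ContinuousLinearMap.star_eq_adjoint, ← ContinuousLinearMap.star_eq_adjoint, star_one,
      ← LinearMap.comp_apply, ← TensorProduct.map_comp] at h2
    exact h.symm.trans h2
  have h4 : (‖TensorProduct.map (S : K →ₗ[ℂ] K) LinearMap.id x‖ : ℂ) ^ 2 +
      (‖TensorProduct.map (R : K →ₗ[ℂ] K) LinearMap.id x‖ : ℂ) ^ 2 =
        ((‖S‖ ^ 2 : ℝ) : ℂ) * (‖x‖ : ℂ) ^ 2 := by
    rw [key S, key R]
    refine (inner_add_right (𝕜 := ℂ) x _ _).symm.trans ?_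
    rw [← LinearMap.add_apply, ← TensorProduct.map_add_left,
      ← ContinuousLinearMap.toLinearMap_add, h3, ContinuousLinearMap.toLinearMap_smul,
      TensorProduct.map_smul_left, LinearMap.smul_apply, inner_smul_right]
    congr 1
    have : TensorProduct.map ((1 : K →L[ℂ] K) : K →ₗ[ℂ] K) (LinearMap.id : K →ₗ[ℂ] K) x = x :=
      LinearMap.congr_fun TensorProduct.map_id x
    rw [this]
    exact inner_self_eq_norm_sq_to_K x
  have h5 : ‖TensorProduct.map (S : K →ₗ[ℂ] K) LinearMap.id x‖ ^ 2 +
      ‖TensorProduct.map (R : K →ₗ[ℂ] K) LinearMap.id x‖ ^ 2 = ‖S‖ ^ 2 * ‖x‖ ^ 2 := by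
    exact_mod_cast h4
  refine le_of_sq_le_sq ?_ (by positivity)
  rw [mul_pow]
  nlinarith [sq_nonneg ‖TensorProduct.map (R : K →ₗ[ℂ] K) LinearMap.id x‖]

theorem norm_tmap (S T : K →L[ℂ] K) (x : K ⊗[ℂ] K) :
    ‖TensorProduct.map (S : K →ₗ[ℂ] K) (T : K →ₗ[ℂ] K) x‖ ≤ ‖S‖ * ‖T‖ * ‖x‖ := by
  have h1 : TensorProduct.map (S : K →ₗ[ℂ] K) (T : K →ₗ[ℂ] K) x =
      TensorProduct.map (S : K →ₗ[ℂ] K) LinearMap.id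
        (TensorProduct.comm ℂ K K (TensorProduct.map (T : K →ₗ[ℂ] K) LinearMap.id
          (TensorProduct.comm ℂ K K x))) := by
    induction x with
    | zero => simp
    | add a b ha hb => simp only [map_add, ha, hb]
    | tmul f g => simp
  rw [h1]
  refine (norm_tmap_left S _).trans ?_
  rw [TensorProduct.norm_comm, mul_assoc]
  refine mul_le_mul_of_nonneg_left ((norm_tmap_left T _).trans ?_) (norm_nonneg _)
  rw [TensorProduct.norm_comm]

end Bound

theorem denseRange_tensorEmb : DenseRange tensorEmb := by
  have : (LinearMap.range tensorEmb).topologicalClosure = ⊤ := by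
    rw [Submodule.topologicalClosure_eq_top_iff, Submodule.eq_bot_iff]
    intro Φ hΦ
    rw [Submodule.mem_orthogonal] at hΦ
    set I : ℕ → Set ℝ := fun n => Set.Icc (-(n : ℝ)) n with hI
    have hIm : ∀ n, MeasurableSet (I n) := fun n => measurableSet_Icc
    have hfin : ∀ n, (volume : Measure (ℝ × ℝ)) (I n ×ˢ I n) < ∞ := fun n =>
      (isCompact_Icc.prod isCompact_Icc).measure_lt_top
    have hint : ∀ n, Integrable Φ (volume.restrict (I n ×ˢ I n)) := fun n => by
      have : IsFiniteMeasure ((volume : Measure (ℝ × ℝ)).restrict (I n ×ˢ I n)) :=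
        ⟨by simpa using hfin n⟩
      exact ((Lp.memLp Φ).restrict _).integrable (by norm_num)
    have hrect : ∀ A B : Set ℝ, MeasurableSet A → MeasurableSet B → ∀ n,
        ∫ u in (A ∩ I n) ×ˢ (B ∩ I n), Φ u = 0 := by
      intro A B hA hB n
      have hAf : (volume : Measure ℝ) (A ∩ I n) ≠ ∞ :=
        ((measure_mono Set.inter_subset_right).trans_lt isCompact_Icc.measure_lt_top).ne
      have hBf : (volume : Measure ℝ) (B ∩ I n) ≠ ∞ :=
        ((measure_mono Set.inter_subset_right).trans_lt isCompact_Icc.measure_lt_top).ne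
      have hAm := hA.inter (hIm n)
      have hBm := hB.inter (hIm n)
      have h := hΦ (tprod (indicatorConstLp 2 hAm hAf (1 : ℂ)) (indicatorConstLp 2 hBm hBf (1 : ℂ)))
        ⟨_ ⊗ₜ _, rfl⟩
      rw [← h, L2.inner_def, ← integral_indicator (hAm.prod hBm)]
      refine integral_congr_ae ?_
      have h1 := (Measure.quasiMeasurePreserving_fst (μ := (volume : Measure ℝ))
        (ν := (volume : Measure ℝ))).ae_eq_comp
        (indicatorConstLp_coeFn (p := 2) (hs := hAm) (hμs := hAf) (c := (1 : ℂ)))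
      have h2 := (Measure.quasiMeasurePreserving_snd (μ := (volume : Measure ℝ))
        (ν := (volume : Measure ℝ))).ae_eq_comp
        (indicatorConstLp_coeFn (p := 2) (hs := hBm) (hμs := hBf) (c := (1 : ℂ)))
      filter_upwards [tprod_coeFn (indicatorConstLp 2 hAm hAf (1 : ℂ))
        (indicatorConstLp 2 hBm hBf (1 : ℂ)), h1, h2] with u h3 h4 h5
      simp only [Function.comp_apply] at h4 h5
      rw [h3, h4, h5]
      by_cases ha : u.1 ∈ A ∩ I n <;> by_cases hb : u.2 ∈ B ∩ I n <;>
        simp [Set.indicator, Set.mem_prod, ha, hb, -Set.mem_inter_iff]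
    have hall : ∀ n, ∀ s : Set (ℝ × ℝ), MeasurableSet s →
        ∫ u in s, Φ u ∂(volume.restrict (I n ×ˢ I n)) = 0 := by
      intro n s hs
      have huniv : ∫ u, Φ u ∂(volume.restrict (I n ×ˢ I n)) = 0 := by
        simpa using hrect Set.univ Set.univ MeasurableSet.univ MeasurableSet.univ n
      induction s, hs using MeasurableSpace.induction_on_inter generateFrom_prod.symm
        isPiSystem_prod with
      | empty => simp
      | basic s hs =>
        obtain ⟨A, hA, B, hB, rfl⟩ := hs
        have hA' : MeasurableSet A := hA
        have hB' : MeasurableSet B := hB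
        rw [Measure.restrict_restrict (hA'.prod hB'), Set.prod_inter_prod]
        exact hrect A B hA' hB' n
      | compl s hs ih => rw [setIntegral_compl hs (hint n), ih, huniv, sub_zero]
      | iUnion f hd hm ih =>
        rw [integral_iUnion hm hd (hint n).integrableOn]
        simp [ih]
    have hz : ∀ n, ∀ᵐ u ∂((volume : Measure (ℝ × ℝ)).restrict (I n ×ˢ I n)), Φ u = 0 := fun n =>
      (hint n).ae_eq_zero_of_forall_setIntegral_eq_zero fun s hs _ => hall n s hs
    have hU : (⋃ n, I n ×ˢ I n) = Set.univ := by
      refine Set.eq_univ_of_forall fun u => ?_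
      obtain ⟨n, hn⟩ := exists_nat_ge (max |u.1| |u.2|)
      exact Set.mem_iUnion.2 ⟨n, abs_le.1 ((le_max_left _ _).trans hn),
        abs_le.1 ((le_max_right _ _).trans hn)⟩
    have hz' := (ae_restrict_iUnion_iff (fun n => I n ×ˢ I n) (fun u => Φ u = 0)).2 hz
    rw [hU, Measure.restrict_univ] at hz'
    ext1
    exact Filter.EventuallyEq.trans hz' (Lp.coeFn_zero _ _ _).symm
  exact (Submodule.dense_iff_topologicalClosure_eq_top.2 this)

/-- `(S ⊗ T)(f ⊗ g) = S f ⊗ T g`. -/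
theorem tensorOp_tprod (S T : H →L[ℂ] H) (f g : H) :
    tensorOp S T (tprod f g) = tprod (S f) (T g) :=
  LinearMap.extendOfNorm_eq denseRange_tensorEmb
    ⟨‖S‖ * ‖T‖, fun x => by
      rw [norm_tensorEmb, LinearMap.comp_apply, norm_tensorEmb]
      exact norm_tmap S T x⟩ (f ⊗ₜ g)

/-! ### Trace, states, observables -/

section General

variable {K : Type*} [NormedAddCommGroup K] [InnerProductSpace ℂ K]

section Trace

variable [CompleteSpace K]

variable (K) in
/-- A fixed orthonormal (Hilbert) basis of `K`. -/
def onb : HilbertBasis (exists_hilbertBasis ℂ K).choose ℂ K :=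
  (exists_hilbertBasis ℂ K).choose_spec.choose

/-- The trace `∑ᵢ ⟨eᵢ, T eᵢ⟩`; for trace class operators it does not depend on the basis. -/
def tr (T : K →L[ℂ] K) : ℂ := ∑' i, ⟪onb K i, T (onb K i)⟫_ℂ

/-- States are positive operators of trace one. -/
structure IsState (ρ : K →L[ℂ] K) : Prop where
  isPositive : ρ.IsPositive
  hasSum_one : HasSum (fun i => ⟪onb K i, ρ (onb K i)⟫_ℂ) 1

end Trace

variable (K) in
/-- An observable with outcome space `α`: a normalized positive operator measure, i.e. a map from
measurable sets to positive operators, weakly `σ`-additive, with `E(α) = I`. (The irrelevant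
values on non-measurable sets are set to `0`.) -/
@[ext]
structure Observable (α : Type*) [MeasurableSpace α] where
  /-- The effect of a set of outcomes. -/
  effect : Set α → K →L[ℂ] K
  effect_of_not_measurableSet : ∀ A, ¬ MeasurableSet A → effect A = 0
  isPositive : ∀ A, MeasurableSet A → (effect A).IsPositive
  effect_univ : effect Set.univ = 1
  hasSum_inner : ∀ A : ℕ → Set α, (∀ n, MeasurableSet (A n)) →
    Pairwise (fun m n => Disjoint (A m) (A n)) → ∀ φ ψ : K,
      HasSum (fun n => ⟪φ, effect (A n) ψ⟫_ℂ) ⟪φ, effect (⋃ n, A n) ψ⟫_ℂ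

namespace Observable

variable {α : Type*} [MeasurableSpace α]

/-- The measure `A ↦ ⟨ψ, E(A) ψ⟩`. -/
def measure (E : Observable K α) (ψ : K) : Measure α :=
  Measure.ofMeasurable (fun A _ => ENNReal.ofReal (⟪ψ, E.effect A ψ⟫_ℂ).re)
    (by
      have h := E.hasSum_inner (fun _ => ∅) (fun _ => MeasurableSet.empty)
        (fun _ _ _ => disjoint_bot_left) ψ ψ
      have h0 : ⟪ψ, E.effect ∅ ψ⟫_ℂ = 0 :=
        tendsto_nhds_unique tendsto_const_nhds h.summable.tendsto_atTop_zero
      simp [h0])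
    (fun A hA hd => by
      have h := Complex.hasSum_re (E.hasSum_inner A hA hd ψ ψ)
      rw [← h.tsum_eq, ENNReal.ofReal_tsum_of_nonneg _ h.summable]
      intro n
      simpa using (E.isPositive (A n) (hA n)).re_inner_nonneg_right ψ)

theorem measure_apply (E : Observable K α) (ψ : K) {A : Set α} (hA : MeasurableSet A) :
    E.measure ψ A = ENNReal.ofReal (⟪ψ, E.effect A ψ⟫_ℂ).re :=
  Measure.ofMeasurable_apply A hA

/-- Projection valued observables. -/
def IsProjectionValued (E : Observable K α) : Prop :=
  ∀ A, MeasurableSet A → IsIdempotentElem (E.effect A)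

/-- `E` is the spectral measure of the (unbounded) operator `T`, i.e. `T = ∫ x dE(x)`: `E` is
projection valued, the domain of `T` consists of the `ψ` with `∫ x² d⟨ψ, E ψ⟩ < ∞`, and
`⟨ψ, T ψ⟩ = ∫ x d⟨ψ, E ψ⟩` on it. -/
structure IsSpectralMeasure (E : Observable K ℝ) (T : K →ₗ.[ℂ] K) : Prop where
  isProjectionValued : E.IsProjectionValued
  mem_domain_iff : ∀ ψ, ψ ∈ T.domain ↔ Integrable (fun x : ℝ => x ^ 2) (E.measure ψ)
  inner_eq : ∀ ψ : T.domain, ⟪(ψ : K), T ψ⟫_ℂ = ((∫ x : ℝ, x ∂(E.measure (ψ : K)) : ℝ) : ℂ)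

end Observable

end General

/-! ### Quadratures -/

/-- Multiplication by the coordinate on Schwartz functions. -/
def posS : 𝓢(ℝ, ℂ) →L[ℂ] 𝓢(ℝ, ℂ) := SchwartzMap.smulLeftCLM ℂ (fun x : ℝ => (x : ℂ))

theorem posS_apply (f : 𝓢(ℝ, ℂ)) (x : ℝ) : posS f x = x * f x := by
  have h : (fun x : ℝ => (x : ℂ)).HasTemperateGrowth :=
    Complex.ofRealCLM.hasTemperateGrowth
  simp [posS, h]

/-- The annihilation operator `a = (x + d/dx)/√2` on Schwartz functions. -/
def annihilation : 𝓢(ℝ, ℂ) →L[ℂ] 𝓢(ℝ, ℂ) :=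
  ((Real.sqrt 2 : ℂ)⁻¹) • (posS + SchwartzMap.derivCLM ℂ ℂ)

/-- The creation operator `a* = (x - d/dx)/√2` on Schwartz functions. -/
def creation : 𝓢(ℝ, ℂ) →L[ℂ] 𝓢(ℝ, ℂ) :=
  ((Real.sqrt 2 : ℂ)⁻¹) • (posS - SchwartzMap.derivCLM ℂ ℂ)

/-- `(e^{iθ} a* + e^{-iθ} a)/√2` on Schwartz functions. -/
def quadratureS (θ : ℝ) : 𝓢(ℝ, ℂ) →L[ℂ] 𝓢(ℝ, ℂ) :=
  ((Real.sqrt 2 : ℂ)⁻¹) • (Complex.exp (Complex.I * θ) • creation +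
    Complex.exp (-(Complex.I * θ)) • annihilation)

/-- The embedding of Schwartz functions into `L²(ℝ)`. -/
def schwartzEmb : 𝓢(ℝ, ℂ) →ₗ[ℂ] H :=
  (SchwartzMap.toLpCLM ℂ ℂ 2 (volume : Measure ℝ) : 𝓢(ℝ, ℂ) →ₗ[ℂ] H)

theorem schwartzEmb_injective : Function.Injective schwartzEmb :=
  SchwartzMap.injective_toLp 2 (volume : Measure ℝ)

/-- The quadrature operator `Q_θ`: the closure in `L²(ℝ)` of `(e^{iθ} a* + e^{-iθ} a)/√2`. -/
def quadrature (θ : ℝ) : H →ₗ.[ℂ] H :=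
  LinearPMap.closure
    { domain := LinearMap.range schwartzEmb
      toFun := schwartzEmb ∘ₗ (quadratureS θ : 𝓢(ℝ, ℂ) →ₗ[ℂ] 𝓢(ℝ, ℂ)) ∘ₗ
        (LinearEquiv.ofInjective schwartzEmb schwartzEmb_injective).symm.toLinearMap }

/-! ### Weyl operators -/

/-- The operator `e^{-iqP}`: the translation `(e^{-iqP} ψ)(x) = ψ(x - q)`. -/
def translation (q : ℝ) : H →L[ℂ] H :=
  (Lp.compMeasurePreservingₗᵢ ℂ (fun x : ℝ => x - q)
    (measurePreserving_sub_right volume q)).toContinuousLinearMap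

theorem memLp_modulation (p : ℝ) (f : H) :
    MemLp (fun x : ℝ => Complex.exp (Complex.I * (p * x)) * f x) 2 (volume : Measure ℝ) := by
  refine (Lp.memLp f).of_le ?_ (Filter.Eventually.of_forall fun x => ?_)
  · exact (by fun_prop : Continuous fun x : ℝ =>
      Complex.exp (Complex.I * (p * x))).aestronglyMeasurable.mul (Lp.aestronglyMeasurable f)
  · rw [norm_mul, mul_comm Complex.I, ← Complex.ofReal_mul, Complex.norm_exp_ofReal_mul_I, one_mul]

/-- The operator `e^{ipQ}`: multiplication by the function `x ↦ e^{ipx}`. -/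
def modulation (p : ℝ) : H →L[ℂ] H :=
  LinearMap.mkContinuous
    { toFun := fun f => (memLp_modulation p f).toLp _
      map_add' := fun f g => by
        ext1
        filter_upwards [(memLp_modulation p (f + g)).coeFn_toLp, Lp.coeFn_add f g,
          Lp.coeFn_add ((memLp_modulation p f).toLp _) ((memLp_modulation p g).toLp _),
          (memLp_modulation p f).coeFn_toLp, (memLp_modulation p g).coeFn_toLp]
          with x h1 h2 h3 h4 h5
        rw [h1, h3, Pi.add_apply, h4, h5, h2, Pi.add_apply, mul_add]
      map_smul' := fun c f => by
        ext1
        filter_upwards [(memLp_modulation p (c • f)).coeFn_toLp, Lp.coeFn_smul c f,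
          Lp.coeFn_smul c ((memLp_modulation p f).toLp _),
          (memLp_modulation p f).coeFn_toLp] with x h1 h2 h3 h4
        rw [h1, RingHom.id_apply, h3, Pi.smul_apply, h4, h2, Pi.smul_apply, mul_smul_comm] }
    1 (fun f => by
      rw [one_mul]
      refine Lp.norm_le_norm_of_ae_le ?_
      filter_upwards [(memLp_modulation p f).coeFn_toLp] with x h
      simp only [LinearMap.coe_mk, AddHom.coe_mk]
      rw [h, norm_mul, mul_comm Complex.I, ← Complex.ofReal_mul, Complex.norm_exp_ofReal_mul_I,
        one_mul])

/-- The Weyl operator `W(q, p) = e^{iqp/2} e^{-iqP} e^{ipQ}`. -/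
def weyl (q p : ℝ) : H →L[ℂ] H :=
  Complex.exp (Complex.I * (q * p / 2)) • (translation q ∘L modulation p)

/-! ### The beam splitter -/

/-- The linear map `(x, y) ↦ ((x + y)/√2, (-x + y)/√2)`. -/
def rot : ℝ × ℝ →ₗ[ℝ] ℝ × ℝ :=
  (Real.sqrt 2)⁻¹ • LinearMap.prod (LinearMap.fst ℝ ℝ ℝ + LinearMap.snd ℝ ℝ ℝ)
    (-LinearMap.fst ℝ ℝ ℝ + LinearMap.snd ℝ ℝ ℝ)

theorem rot_apply (x y : ℝ) :
    rot (x, y) = ((Real.sqrt 2)⁻¹ * (x + y), (Real.sqrt 2)⁻¹ * (-x + y)) := rfl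

theorem det_rot : LinearMap.det rot = 1 := by
  rw [← LinearMap.det_toMatrix (Module.Basis.finTwoProd ℝ), Matrix.det_fin_two]
  simp only [LinearMap.toMatrix_apply, Module.Basis.finTwoProd_zero,
    Module.Basis.finTwoProd_one, rot_apply, Module.Basis.coe_finTwoProd_repr]
  have h : Real.sqrt 2 * Real.sqrt 2 = 2 := Real.mul_self_sqrt (by norm_num)
  have h' : Real.sqrt 2 ≠ 0 := by positivity
  simp
  field_simp
  nlinarith

theorem measurePreserving_rot :
    MeasurePreserving rot (volume : Measure (ℝ × ℝ)) (volume : Measure (ℝ × ℝ)) := by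
  refine ⟨rot.continuous_of_finiteDimensional.measurable, ?_⟩
  have h := Measure.map_linearMap_addHaar_eq_smul_addHaar (volume : Measure (ℝ × ℝ))
    (f := rot) (by rw [det_rot]; exact one_ne_zero)
  simpa [det_rot] using h

/-- The 50:50 beam splitter in the coordinate representation,
`(U Ψ)(x, y) = Ψ((x + y)/√2, (-x + y)/√2)`. -/
def beamSplitter : H₂ →L[ℂ] H₂ :=
  (Lp.compMeasurePreservingₗᵢ ℂ rot measurePreserving_rot).toContinuousLinearMap

/-- The wave function
`π^{-1/4} exp(-x²/2 + √2 z x - z²/2 - |z|²/2)` of the coherent state `|z⟩`. -/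
def coherentFun (z : ℂ) (x : ℝ) : ℂ :=
  ((Real.pi ^ (-(1 / 4) : ℝ) : ℝ) : ℂ) *
    Complex.exp (-(x : ℂ) ^ 2 / 2 + Real.sqrt 2 * z * x - z ^ 2 / 2 - (‖z‖ : ℂ) ^ 2 / 2)

theorem memLp_coherentFun (z : ℂ) : MemLp (coherentFun z) 2 (volume : Measure ℝ) := by
  have hc : Continuous (coherentFun z) := by unfold coherentFun; fun_prop
  rw [memLp_two_iff_integrable_sq_norm hc.aestronglyMeasurable]
  have h := ((integrable_exp_neg_mul_sq one_pos).comp_sub_right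
    (Real.sqrt 2 * z.re)).const_mul ((Real.pi ^ (-(1 / 4) : ℝ)) ^ 2)
  refine h.congr (Filter.Eventually.of_forall fun x => ?_)
  have hs : Real.sqrt 2 ^ 2 = 2 := Real.sq_sqrt (by norm_num)
  have hn : ‖z‖ ^ 2 = z.re ^ 2 + z.im ^ 2 := by
    rw [Complex.sq_norm, Complex.normSq_apply]; ring
  have hre : (-(x : ℂ) ^ 2 / 2 + Real.sqrt 2 * z * x - z ^ 2 / 2 - (‖z‖ : ℂ) ^ 2 / 2).re =
      -(x - Real.sqrt 2 * z.re) ^ 2 / 2 := by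
    rw [← Complex.ofReal_pow ‖z‖, hn]
    simp [pow_two]
    nlinarith
  simp only [coherentFun, norm_mul, Complex.norm_exp, hre, mul_pow, Complex.norm_real,
    Real.norm_eq_abs, sq_abs]
  rw [← Real.exp_nat_mul]
  congr 2
  push_cast
  ring

/-- The coherent state `|z⟩`. -/
def coherent (z : ℂ) : H := (memLp_coherentFun z).toLp _

/-- The beam splitter is the unitary operator that acts on coherent states by
`|z⟩ ⊗ |w⟩ ↦ |(z - w)/√2⟩ ⊗ |(z + w)/√2⟩`. -/
theorem beamSplitter_coherent (z w : ℂ) :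
    beamSplitter (tprod (coherent z) (coherent w)) =
      tprod (coherent ((Real.sqrt 2 : ℂ)⁻¹ * (z - w))) (coherent ((Real.sqrt 2 : ℂ)⁻¹ * (z + w))) := by
  have hcoh : ∀ z w : ℂ, tprod (coherent z) (coherent w) =ᵐ[(volume : Measure (ℝ × ℝ))]
      fun u => coherentFun z u.1 * coherentFun w u.2 := by
    intro z w
    have h1 := (Measure.quasiMeasurePreserving_fst (μ := (volume : Measure ℝ))
        (ν := (volume : Measure ℝ))).ae_eq_comp (memLp_coherentFun z).coeFn_toLp
    have h2 := (Measure.quasiMeasurePreserving_snd (μ := (volume : Measure ℝ))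
        (ν := (volume : Measure ℝ))).ae_eq_comp (memLp_coherentFun w).coeFn_toLp
    filter_upwards [tprod_coeFn (coherent z) (coherent w), h1, h2] with u h h1 h2
    simp only [Function.comp_apply] at h1 h2
    rw [h]
    exact congrArg₂ _ h1 h2
  ext1
  filter_upwards [Lp.coeFn_compMeasurePreserving (tprod (coherent z) (coherent w))
      measurePreserving_rot, measurePreserving_rot.quasiMeasurePreserving.ae_eq_comp (hcoh z w),
    hcoh ((Real.sqrt 2 : ℂ)⁻¹ * (z - w)) ((Real.sqrt 2 : ℂ)⁻¹ * (z + w))] with u h1 h2 h3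
  refine h1.trans (h2.trans (Eq.trans ?_ h3.symm))
  obtain ⟨x, y⟩ := u
  have hs : (Real.sqrt 2 : ℂ) ^ 2 = 2 := by
    rw [← Complex.ofReal_pow, Real.sq_sqrt (by norm_num)]; norm_num
  have hs0 : (Real.sqrt 2 : ℂ) ≠ 0 := by
    intro h; rw [h] at hs; norm_num at hs
  have hn : ∀ z : ℂ, (‖z‖ : ℂ) ^ 2 = z * (starRingEnd ℂ) z := fun z =>
    (Complex.mul_conj' z).symm
  simp only [Function.comp_apply, rot_apply, coherentFun]
  rw [mul_mul_mul_comm, ← Complex.exp_add, mul_mul_mul_comm, ← Complex.exp_add]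
  congr 2
  simp only [hn, map_mul, map_sub, map_add, map_inv₀, Complex.conj_ofReal, Complex.ofReal_mul,
    Complex.ofReal_add, Complex.ofReal_neg, Complex.ofReal_inv]
  field_simp
  rw [hs]
  ring

/-! ### The measured observable -/

/-- `E` is the signal observable measured in the high-amplitude limit with phase shift `θ` and
parameter field `σ`: for all states `ρ` and all Borel sets `X`, `Y`,
`tr[ρ E(X × Y)] = tr[U (ρ ⊗ σ) U* (𝖰(X/√2) ⊗ 𝖰_θ(Y/√2))]`,
where `𝖰` and `𝖰_θ` are the spectral measures of `Q_0` and `Q_θ`. -/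
def IsHighAmplitudeObservable (θ : ℝ) (σ : H →L[ℂ] H) (E : Observable H (ℝ × ℝ)) : Prop :=
  ∃ Q Qθ : Observable H ℝ, Q.IsSpectralMeasure (quadrature 0) ∧
    Qθ.IsSpectralMeasure (quadrature θ) ∧
    ∀ ρ : H →L[ℂ] H, IsState ρ → ∀ X Y : Set ℝ, MeasurableSet X → MeasurableSet Y →
      tr (ρ ∘L E.effect (X ×ˢ Y)) =
        tr ((beamSplitter ∘L tensorOp ρ σ ∘L ContinuousLinearMap.adjoint beamSplitter) ∘L
          tensorOp (Q.effect ((fun x => x / Real.sqrt 2) '' X))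
            (Qθ.effect ((fun y => y / Real.sqrt 2) '' Y)))

/-- Covariance under the Weyl representation: `W(q, p) E(Z) W(q, p)* = E(Z + (q, p))`. -/
def IsCovariant (E : Observable H (ℝ × ℝ)) : Prop :=
  ∀ (q p : ℝ) (Z : Set (ℝ × ℝ)), MeasurableSet Z →
    weyl q p ∘L E.effect Z ∘L ContinuousLinearMap.adjoint (weyl q p) =
      E.effect ((fun z => z + (q, p)) '' Z)

end EightPort

end

noncomputable section

namespace EightPort

/-! ### Operations on observables -/

section Operations

variable {K L : Type*} [NormedAddCommGroup K] [InnerProductSpace ℂ K]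
  [NormedAddCommGroup L] [InnerProductSpace ℂ L]
  {α β : Type*} [MeasurableSpace α] [MeasurableSpace β]

/-! Uniqueness has two layers. An observable is determined by its finite measures `⟨ψ, E(·) ψ⟩`,
hence on a product space by its values on rectangles, and those values are fixed by expectations in
pure states. But the right-hand side of the defining formula involves spectral measures described
only through domain and first moment, so these must themselves be shown unique
(`IsSpectralMeasure.unique`). If `E` and `F` both belong to `T`, then powers of `T - m` grow at most
like `r ^ n` on the range of `E [m - r, m + r]` and at least like `(c - m) ^ n` on the range of `F
[c, ∞)`; since `F` reduces `T`, the product of the two projections vanishes when `m + r < c`. Hence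
the projections onto half-lines coincide.

For existence, `Q_θ = cos θ x + sin θ (-i d/dx)` is turned into multiplication by a multiple of `x`:
nothing is needed when `sin θ = 0`, otherwise the chirp `e^{i cot θ x² / 2}` removes the term in `x`
and the Fourier transform does the rest (`exists_diagonalizes`). The indicator functions of the
transformed coordinate form the spectral measure, and tensoring two diagonalizations gives a joint
observable on `L²(ℝ²)` (`exists_joint_observable`). With `S = √σ`, compressing it by the maps `φ ↦ U
(φ ⊗ S e_k)` and summing over `k` yields the measured observable (`exists_isMeasured`). That it has
the prescribed expectations is cyclicity of the trace for the Hilbert–Schmidt operator `(√ρ ⊗ √σ)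
U*` (`tr_comp_eq_tr_beamSplitter`).

For the transformation law, `W(q, p)` moves `Q_θ` by `s = q cos θ + p sin θ`, so by uniqueness it
translates the spectral measure (`adjoint_weyl_effect_weyl`). The beam splitter carries `W(q, p) ⊗
1` to `W(q/√2, p/√2) ⊗ W(q/√2, p/√2)` (`beamSplitter_weyl`), and the rescaling by `√2` restores the
shift `(q, s)`. If covariance also holds, comparing the two laws at `(0, 1)` makes `E` invariant
under translation by `(0, 1 - sin θ)`. A nonzero finite measure on the line has no nonzero period
(`eq_zero_of_invariant`), hence `sin θ = 1`; conversely `sin θ = 1` forces `cos θ = 0` and the shift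
is `(q, p)`. -/

theorem clm_ext_of_inner_self {S T : K →L[ℂ] K} (h : ∀ x, ⟪x, S x⟫_ℂ = ⟪x, T x⟫_ℂ) : S = T := by
  refine ContinuousLinearMap.coe_injective ((ext_inner_map _ _).1 fun x => ?_)
  have := congrArg (starRingEnd ℂ) (h x)
  rwa [inner_conj_symm, inner_conj_symm] at this

namespace Observable

theorem inner_effect_comm (E : Observable K α) (A : Set α) (φ ψ : K) :
    ⟪φ, E.effect A ψ⟫_ℂ = ⟪E.effect A φ, ψ⟫_ℂ := by
  by_cases hA : MeasurableSet A
  · exact ((E.isPositive A hA).isSymmetric φ ψ).symm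
  · simp [E.effect_of_not_measurableSet A hA]

theorem measure_univ (E : Observable K α) (ψ : K) :
    E.measure ψ Set.univ = ENNReal.ofReal (‖ψ‖ ^ 2) := by
  rw [measure_apply _ _ MeasurableSet.univ, effect_univ, one_apply_eq_self,
    inner_self_eq_norm_sq_to_K]
  norm_cast

instance (E : Observable K α) (ψ : K) : IsFiniteMeasure (E.measure ψ) :=
  ⟨by rw [measure_univ]; exact ENNReal.ofReal_lt_top⟩

theorem measureReal_univ (E : Observable K α) (ψ : K) :
    (E.measure ψ).real Set.univ = ‖ψ‖ ^ 2 := by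
  rw [Measure.real, measure_univ, ENNReal.toReal_ofReal (by positivity)]

theorem inner_effect_self (E : Observable K α) (ψ : K) {A : Set α} (hA : MeasurableSet A) :
    ⟪ψ, E.effect A ψ⟫_ℂ = ((E.measure ψ).real A : ℂ) := by
  have h := (E.isPositive A hA).inner_nonneg_right ψ
  rw [Measure.real, measure_apply _ _ hA, ENNReal.toReal_ofReal (Complex.nonneg_iff.1 h).1]
  exact Complex.ext rfl (by simpa using (Complex.nonneg_iff.1 h).2.symm)

theorem ext_of_measurableSet {E F : Observable K α}
    (h : ∀ A, MeasurableSet A → E.effect A = F.effect A) : E = F := by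
  refine Observable.ext (funext fun A => ?_)
  by_cases hA : MeasurableSet A
  · exact h A hA
  · rw [E.effect_of_not_measurableSet A hA, F.effect_of_not_measurableSet A hA]

/-- The diagonal measures of both observables are finite with the same total mass `‖ψ‖²`, so
agreement on a generating π-system suffices; complex polarization recovers the operators. -/
theorem ext_of_generateFrom {E F : Observable K α} (C : Set (Set α))
    (hgen : ‹MeasurableSpace α› = MeasurableSpace.generateFrom C) (hpi : IsPiSystem C)
    (h : ∀ A ∈ C, E.effect A = F.effect A) : E = F := by
  have key : ∀ ψ, E.measure ψ = F.measure ψ := fun ψ => by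
    refine MeasureTheory.ext_of_generate_finite C hgen hpi (fun A hA => ?_) ?_
    · have hm : MeasurableSet A := by
        rw [hgen]; exact MeasurableSpace.measurableSet_generateFrom hA
      rw [measure_apply _ _ hm, measure_apply _ _ hm, h A hA]
    · rw [measure_univ, measure_univ]
  refine ext_of_measurableSet fun A hA => clm_ext_of_inner_self fun ψ => ?_
  rw [inner_effect_self _ _ hA, inner_effect_self _ _ hA, key]

/-- Observables on a product space are determined by their values on measurable rectangles. -/
theorem ext_of_prod {E F : Observable K (α × β)}
    (h : ∀ X Y, MeasurableSet X → MeasurableSet Y → E.effect (X ×ˢ Y) = F.effect (X ×ˢ Y)) :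
    E = F := by
  refine ext_of_generateFrom _ generateFrom_prod.symm isPiSystem_prod ?_
  rintro _ ⟨X, hX, Y, hY, rfl⟩
  exact h X Y hX hY

theorem measure_real_le (E : Observable K α) (ψ : K) (A : Set α) :
    (E.measure ψ).real A ≤ ‖ψ‖ ^ 2 := by
  rw [← E.measureReal_univ ψ]
  exact measureReal_mono (Set.subset_univ A)

/-- For `σ`-additivity it is enough to look at the diagonal matrix elements. -/
def ofDiagonal (e : Set α → K →L[ℂ] K) (h0 : ∀ A, ¬ MeasurableSet A → e A = 0)
    (hpos : ∀ A, MeasurableSet A → (e A).IsPositive) (huniv : e Set.univ = 1)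
    (hsum : ∀ A : ℕ → Set α, (∀ n, MeasurableSet (A n)) →
      Pairwise (fun m n => Disjoint (A m) (A n)) → ∀ ψ : K,
        HasSum (fun n => ⟪ψ, e (A n) ψ⟫_ℂ) ⟪ψ, e (⋃ n, A n) ψ⟫_ℂ) : Observable K α where
  effect := e
  effect_of_not_measurableSet := h0
  isPositive := hpos
  effect_univ := huniv
  hasSum_inner A hA hd φ ψ := by
    have hpol : ∀ B, MeasurableSet B → ⟪φ, e B ψ⟫_ℂ =
        (⟪ψ + φ, e B (ψ + φ)⟫_ℂ - ⟪ψ - φ, e B (ψ - φ)⟫_ℂ +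
          Complex.I * ⟪ψ + Complex.I • φ, e B (ψ + Complex.I • φ)⟫_ℂ -
          Complex.I * ⟪ψ - Complex.I • φ, e B (ψ - Complex.I • φ)⟫_ℂ) / 4 := fun B hB => by
      have hs := (hpos B hB).isSymmetric
      have := inner_map_polarization (e B : K →ₗ[ℂ] K) ψ φ
      simp only [hs.apply_clm, ContinuousLinearMap.coe_coe] at this
      simpa only [hs.apply_clm, ContinuousLinearMap.coe_coe, ← hs _ _] using this
    simp only [fun n => hpol (A n) (hA n), hpol _ (MeasurableSet.iUnion hA)]
    have h := hsum A hA hd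
    exact ((((h _).sub (h _)).add ((h _).mul_left _)).sub ((h _).mul_left _)).div_const _

/-- The image of an observable under a measurable map of the outcomes. -/
def map (E : Observable K α) (f : α → β) (hf : Measurable f) : Observable K β where
  effect A := open Classical in if MeasurableSet A then E.effect (f ⁻¹' A) else 0
  effect_of_not_measurableSet A hA := by simp [hA]
  isPositive A hA := by simpa [hA] using E.isPositive _ (hf hA)
  effect_univ := by simpa using E.effect_univ
  hasSum_inner A hA hd φ ψ := by
    simp only [hA, MeasurableSet.iUnion hA, if_true, Set.preimage_iUnion]
    exact E.hasSum_inner _ (fun n => hf (hA n)) (fun m n hmn => (hd hmn).preimage f) φ ψ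

theorem map_effect (E : Observable K α) {f : α → β} (hf : Measurable f) {A : Set β}
    (hA : MeasurableSet A) : (E.map f hf).effect A = E.effect (f ⁻¹' A) := by
  simp [map, hA]

theorem measure_map (E : Observable K α) {f : α → β} (hf : Measurable f) (ψ : K) :
    (E.map f hf).measure ψ = (E.measure ψ).map f := by
  ext A hA
  rw [measure_apply _ _ hA, map_effect _ _ hA, Measure.map_apply hf hA, measure_apply _ _ (hf hA)]

theorem IsProjectionValued.map {E : Observable K α} (hE : E.IsProjectionValued) {f : α → β}
    (hf : Measurable f) : (E.map f hf).IsProjectionValued := fun A hA => by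
  rw [map_effect _ _ hA]
  exact hE _ (hf hA)

variable [CompleteSpace K] [CompleteSpace L]

/-- The compression `A ↦ V* E(A) V` of an observable by an isometry `V`. -/
def conj (E : Observable K α) (V : L →L[ℂ] K) (hV : ContinuousLinearMap.adjoint V ∘L V = 1) :
    Observable L α where
  effect A := ContinuousLinearMap.adjoint V ∘L E.effect A ∘L V
  effect_of_not_measurableSet A hA := by simp [E.effect_of_not_measurableSet A hA]
  isPositive A hA := by
    simpa using (E.isPositive A hA).conj_adjoint (ContinuousLinearMap.adjoint V)
  effect_univ := by
    rw [E.effect_univ, ← hV]; rfl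
  hasSum_inner A hA hd φ ψ := by
    simpa [ContinuousLinearMap.adjoint_inner_right] using E.hasSum_inner A hA hd (V φ) (V ψ)

theorem conj_effect (E : Observable K α) (V : L →L[ℂ] K)
    (hV : ContinuousLinearMap.adjoint V ∘L V = 1) (A : Set α) :
    (E.conj V hV).effect A = ContinuousLinearMap.adjoint V ∘L E.effect A ∘L V := rfl

theorem measure_conj (E : Observable K α) (V : L →L[ℂ] K)
    (hV : ContinuousLinearMap.adjoint V ∘L V = 1) (ψ : L) :
    (E.conj V hV).measure ψ = E.measure (V ψ) := by
  ext A hA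
  rw [measure_apply _ _ hA, measure_apply _ _ hA, conj_effect]
  simp [ContinuousLinearMap.adjoint_inner_right]

theorem IsProjectionValued.conj {E : Observable K α} (hE : E.IsProjectionValued) (V : L →L[ℂ] K)
    (hV : ContinuousLinearMap.adjoint V ∘L V = 1) (hV' : V ∘L ContinuousLinearMap.adjoint V = 1) :
    (E.conj V hV).IsProjectionValued := fun A hA => by
  have h : ∀ x, V (ContinuousLinearMap.adjoint V x) = x := fun x => DFunLike.congr_fun hV' x
  ext x
  have h2 := DFunLike.congr_fun (hE A hA).eq (V x)
  rw [mul_apply_eq_comp] at h2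
  simp [conj_effect, h, h2]

theorem summable_dilation (E : Observable K α) {ι : Type*} {J : ι → L →L[ℂ] K}
    (hJs : Summable fun k => ‖J k‖ ^ 2) (A : Set α) :
    Summable fun k => ContinuousLinearMap.adjoint (J k) ∘L E.effect A ∘L J k := by
  refine Summable.of_norm_bounded (hJs.mul_left ‖E.effect A‖) fun k => ?_
  refine (ContinuousLinearMap.opNorm_comp_le _ _).trans ?_
  rw [LinearIsometryEquiv.norm_map]
  calc ‖J k‖ * ‖E.effect A ∘L J k‖ ≤ ‖J k‖ * (‖E.effect A‖ * ‖J k‖) := by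
        gcongr; exact ContinuousLinearMap.opNorm_comp_le _ _
    _ = _ := by ring

theorem hasSum_inner_dilation (E : Observable K α) {ι : Type*} {J : ι → L →L[ℂ] K}
    (hJs : Summable fun k => ‖J k‖ ^ 2) (A : Set α) (φ ψ : L) :
    HasSum (fun k => ⟪J k φ, E.effect A (J k ψ)⟫_ℂ)
      ⟪φ, (∑' k, ContinuousLinearMap.adjoint (J k) ∘L E.effect A ∘L J k) ψ⟫_ℂ := by
  have h := ((innerSL ℂ φ) ∘L (ContinuousLinearMap.apply ℂ L ψ)).hasSum
    (E.summable_dilation hJs A).hasSum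
  simpa [Function.comp_def, ContinuousLinearMap.adjoint_inner_right] using h

/-- The observable `A ↦ ∑ₖ Jₖ* E(A) Jₖ`, where `∑ₖ Jₖ* Jₖ = 1`. -/
def dilate (E : Observable K α) {ι : Type*} (J : ι → L →L[ℂ] K)
    (hJs : Summable fun k => ‖J k‖ ^ 2)
    (hJ : ∀ φ, HasSum (fun k => ‖J k φ‖ ^ 2) (‖φ‖ ^ 2)) : Observable L α :=
  ofDiagonal (fun A => ∑' k, ContinuousLinearMap.adjoint (J k) ∘L E.effect A ∘L J k)
    (fun A hA => by simp [E.effect_of_not_measurableSet A hA])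
    (fun A hA => by
      rw [ContinuousLinearMap.isPositive_iff_complex]
      intro ψ
      have h := E.hasSum_inner_dilation hJs A ψ ψ
      have h1 : ∀ k, ⟪J k ψ, E.effect A (J k ψ)⟫_ℂ = ((E.measure (J k ψ)).real A : ℂ) :=
        fun k => E.inner_effect_self _ hA
      simp only [h1] at h
      have h2 : Summable fun k => (E.measure (J k ψ)).real A := by
        have := Complex.hasSum_re h
        simpa using this.summable
      have h3 := h.unique (Complex.hasSum_ofReal.2 h2.hasSum)
      rw [← inner_conj_symm, h3]
      simp [tsum_nonneg])
    (clm_ext_of_inner_self fun ψ => by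
      have h := E.hasSum_inner_dilation hJs Set.univ ψ ψ
      have h' := Complex.hasSum_ofReal.2 (hJ ψ)
      rw [one_apply_eq_self, inner_self_eq_norm_sq_to_K]
      refine h.unique ?_
      simpa [E.effect_univ, inner_self_eq_norm_sq_to_K] using h')
    (fun A hA hd ψ => by
      have h1 : ∀ n, ⟪ψ, (∑' k, ContinuousLinearMap.adjoint (J k) ∘L E.effect (A n) ∘L J k) ψ⟫_ℂ =
          ∑' k, ((E.measure (J k ψ)).real (A n) : ℂ) := fun n => by
        rw [← (E.hasSum_inner_dilation hJs (A n) ψ ψ).tsum_eq]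
        simp only [E.inner_effect_self _ (hA n)]
      rw [← (E.hasSum_inner_dilation hJs (⋃ n, A n) ψ ψ).tsum_eq]
      simp only [h1, E.inner_effect_self _ (MeasurableSet.iUnion hA)]
      have hb : ∀ B k, (E.measure (J k ψ)).real B ≤ ‖J k ψ‖ ^ 2 := fun B k => E.measure_real_le _ _
      have hs : ∀ B, Summable fun k => (E.measure (J k ψ)).real B := fun B =>
        Summable.of_nonneg_of_le (fun k => measureReal_nonneg) (hb B) (hJ ψ).summable
      have hn : ∀ k, HasSum (fun n => (E.measure (J k ψ)).real (A n))
          ((E.measure (J k ψ)).real (⋃ n, A n)) := fun k => by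
        have := E.hasSum_inner A hA hd (J k ψ) (J k ψ)
        simp only [E.inner_effect_self _ (MeasurableSet.iUnion hA),
          fun n => E.inner_effect_self (J k ψ) (hA n)] at this
        exact Complex.hasSum_ofReal.1 this
      simp only [← Complex.ofReal_tsum]
      refine Complex.hasSum_ofReal.2 ?_
      have hfin : ∀ s : Finset ℕ, ∑ n ∈ s, ∑' k, (E.measure (J k ψ)).real (A n) =
          ∑' k, ∑ n ∈ s, (E.measure (J k ψ)).real (A n) := fun s =>
        (Summable.tsum_finsetSum fun n _ => hs (A n)).symm
      unfold HasSum
      simp only [hfin]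
      -- The sums over `n` and `k` are exchanged by dominated convergence: every partial sum over
      -- `n` of the `k`-th measure is at most its total mass `‖J k ψ‖²`, which is summable in `k`.
      refine tendsto_tsum_of_dominated_convergence (hJ ψ).summable (fun k => hn k)
        (Filter.Eventually.of_forall fun s k => ?_)
      rw [Real.norm_of_nonneg (Finset.sum_nonneg fun n _ => measureReal_nonneg)]
      exact (sum_le_hasSum s (fun n _ => measureReal_nonneg) (hn k)).trans (hb _ k))

theorem hasSum_inner_dilate (E : Observable K α) {ι : Type*} (J : ι → L →L[ℂ] K)
    (hJs : Summable fun k => ‖J k‖ ^ 2)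
    (hJ : ∀ φ, HasSum (fun k => ‖J k φ‖ ^ 2) (‖φ‖ ^ 2)) (A : Set α) (φ ψ : L) :
    HasSum (fun k => ⟪J k φ, E.effect A (J k ψ)⟫_ℂ) ⟪φ, (E.dilate J hJs hJ).effect A ψ⟫_ℂ :=
  E.hasSum_inner_dilation hJs A φ ψ

end Observable

end Operations

/-! ### Uniqueness of spectral measures -/

namespace Observable

/-! ### Multiplicativity of projection valued observables -/

section ProjectionValued

variable {K : Type*} [NormedAddCommGroup K] [InnerProductSpace ℂ K]
  {α : Type*} [MeasurableSpace α] {E : Observable K α}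

theorem effect_union (E : Observable K α) {A B : Set α} (hA : MeasurableSet A)
    (hB : MeasurableSet B) (hd : Disjoint A B) :
    E.effect (A ∪ B) = E.effect A + E.effect B := by
  refine clm_ext_of_inner_self fun ψ => ?_
  rw [add_apply, inner_add_right, E.inner_effect_self _ (hA.union hB),
    E.inner_effect_self _ hA, E.inner_effect_self _ hB, measureReal_union hd hB]
  push_cast
  rfl

theorem effect_compl (E : Observable K α) {A : Set α} (hA : MeasurableSet A) :
    E.effect Aᶜ = 1 - E.effect A := by
  rw [eq_sub_iff_add_eq', ← E.effect_union hA hA.compl disjoint_compl_right, Set.union_compl_self,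
    E.effect_univ]

namespace IsProjectionValued

/-- The sum of the two projections `P` and `Q` is again idempotent, so `PQ + QP = 0`. Multiplying by
`P` on either side gives `PQ = -PQP = QP`, hence `2PQ = 0`. -/
theorem effect_mul_of_disjoint (hE : E.IsProjectionValued) {A B : Set α} (hA : MeasurableSet A)
    (hB : MeasurableSet B) (hd : Disjoint A B) : E.effect A * E.effect B = 0 := by
  have hP := (hE A hA).eq
  have hQ := (hE B hB).eq
  have hS := (hE _ (hA.union hB)).eq
  rw [E.effect_union hA hB hd] at hS
  set P := E.effect A
  set Q := E.effect B
  have h0 : P * Q + Q * P = 0 := by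
    have : (P + Q) * (P + Q) = P * P + Q * Q + (P * Q + Q * P) := by noncomm_ring
    rw [this, hP, hQ] at hS
    simpa using hS
  have h1 : P * Q + P * Q * P = 0 := by
    calc P * Q + P * Q * P = P * P * Q + P * Q * P := by rw [hP]
      _ = P * (P * Q + Q * P) := by noncomm_ring
      _ = 0 := by rw [h0, mul_zero]
  have h2 : P * Q * P + Q * P = 0 := by
    calc P * Q * P + Q * P = P * Q * P + Q * (P * P) := by rw [hP]
      _ = (P * Q + Q * P) * P := by noncomm_ring
      _ = 0 := by rw [h0, zero_mul]
  have h3 : P * Q = Q * P := by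
    rw [eq_neg_of_add_eq_zero_left h1, eq_neg_of_add_eq_zero_right h2]
  rw [← h3, ← two_smul ℂ] at h0
  exact (smul_eq_zero.1 h0).resolve_left two_ne_zero

theorem effect_mul (hE : E.IsProjectionValued) {A B : Set α} (hA : MeasurableSet A)
    (hB : MeasurableSet B) : E.effect A * E.effect B = E.effect (A ∩ B) := by
  have hAB := hA.inter hB
  have h1 : E.effect A = E.effect (A ∩ B) + E.effect (A \ B) := by
    rw [← E.effect_union hAB (hA.diff hB) Set.disjoint_sdiff_inter.symm, Set.inter_union_sdiff]
  have h2 : E.effect B = E.effect (A ∩ B) + E.effect (B \ A) := by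
    rw [← E.effect_union hAB (hB.diff hA)
      (Set.disjoint_sdiff_right.mono_left Set.inter_subset_left), Set.inter_comm A B,
      Set.inter_union_sdiff]
  rw [h2, mul_add, effect_mul_of_disjoint hE hA (hB.diff hA) Set.disjoint_sdiff_right, add_zero]
  nth_rewrite 1 [h1]
  rw [add_mul, effect_mul_of_disjoint hE (hA.diff hB) hAB
    (Set.disjoint_sdiff_left.mono_right Set.inter_subset_right), add_zero]
  exact (hE _ hAB).eq

theorem effect_effect (hE : E.IsProjectionValued) {A B : Set α} (hA : MeasurableSet A)
    (hB : MeasurableSet B) (ψ : K) : E.effect A (E.effect B ψ) = E.effect (A ∩ B) ψ := by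
  rw [← hE.effect_mul hA hB, mul_apply_eq_comp]

theorem effect_apply_self (hE : E.IsProjectionValued) {A : Set α} (hA : MeasurableSet A) (ψ : K) :
    E.effect A (E.effect A ψ) = E.effect A ψ := by
  rw [hE.effect_effect hA hA, Set.inter_self]

theorem measure_effect (hE : E.IsProjectionValued) {A : Set α} (hA : MeasurableSet A) (ψ : K) :
    E.measure (E.effect A ψ) = (E.measure ψ).restrict A := by
  ext B hB
  rw [Measure.restrict_apply hB, measure_apply _ _ hB, measure_apply _ _ (hB.inter hA),
    ← E.inner_effect_comm, hE.effect_effect hB hA, hE.effect_effect hA (hB.inter hA),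
    Set.inter_eq_self_of_subset_right Set.inter_subset_right]

/-- `E.effect A` commutes with every `E.effect B`, so vectors from its range and its kernel have no
cross terms. -/
theorem measure_add (hE : E.IsProjectionValued) {A : Set α} (hA : MeasurableSet A) {φ ψ : K}
    (hφ : E.effect A φ = φ) (hψ : E.effect A ψ = 0) :
    E.measure (φ + ψ) = E.measure φ + E.measure ψ := by
  ext B hB
  have h1 : ⟪φ, E.effect B ψ⟫_ℂ = 0 := by
    rw [← hφ, ← E.inner_effect_comm, hE.effect_effect hA hB, Set.inter_comm,
      ← hE.effect_effect hB hA, hψ]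
    simp
  have h2 : ⟪ψ, E.effect B φ⟫_ℂ = 0 := by
    rw [E.inner_effect_comm, ← inner_conj_symm, h1, map_zero]
  have h3 : ⟪φ + ψ, E.effect B (φ + ψ)⟫_ℂ = ⟪φ, E.effect B φ⟫_ℂ + ⟪ψ, E.effect B ψ⟫_ℂ := by
    rw [map_add, inner_add_left, inner_add_right, inner_add_right, h1, h2]
    ring
  rw [Measure.add_apply, measure_apply _ _ hB, measure_apply _ _ hB, measure_apply _ _ hB, h3,
    Complex.add_re, ENNReal.ofReal_add]
  · exact (E.isPositive B hB).re_inner_nonneg_right φ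
  · exact (E.isPositive B hB).re_inner_nonneg_right ψ

theorem effect_eq_zero_of_measure (hE : E.IsProjectionValued) {A : Set α} (hA : MeasurableSet A)
    {ψ : K} (h : E.measure ψ A = 0) : E.effect A ψ = 0 := by
  have h1 := E.inner_effect_self ψ hA
  rw [Measure.real, h, ← hE.effect_apply_self hA, E.inner_effect_comm] at h1
  simpa using h1

end IsProjectionValued

end ProjectionValued

/-! ### Comparison of two spectral measures of one operator -/

namespace IsSpectralMeasure

variable {K : Type*} [NormedAddCommGroup K] [InnerProductSpace ℂ K]
  {E F : Observable K ℝ} {T : K →ₗ.[ℂ] K}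

theorem inner_eq_of_mem_graph (hE : E.IsSpectralMeasure T) {φ φ' : K} (h : (φ, φ') ∈ T.graph) :
    ⟪φ, φ'⟫_ℂ = ((∫ x : ℝ, x ∂(E.measure φ) : ℝ) : ℂ) := by
  obtain ⟨y, rfl, rfl⟩ := T.mem_graph_iff.1 h
  exact hE.inner_eq y

theorem smul_mem_graph (c : ℂ) {φ φ' : K} (h : (φ, φ') ∈ T.graph) : (c • φ, c • φ') ∈ T.graph :=
  T.graph.smul_mem c h

theorem integrable_sq (hE : E.IsSpectralMeasure T) {φ φ' : K} (h : (φ, φ') ∈ T.graph) :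
    Integrable (fun x : ℝ => x ^ 2) (E.measure φ) :=
  (hE.mem_domain_iff φ).1 (T.mem_domain_of_mem_graph h)

theorem integrable_id (hE : E.IsSpectralMeasure T) {φ φ' : K} (h : (φ, φ') ∈ T.graph) :
    Integrable (fun x : ℝ => x) (E.measure φ) :=
  ((memLp_two_iff_integrable_sq (by fun_prop)).2 (hE.integrable_sq h)).integrable (by norm_num)

theorem exists_mem_graph (hE : E.IsSpectralMeasure T) {φ : K}
    (h : Integrable (fun x : ℝ => x ^ 2) (E.measure φ)) : ∃ φ', (φ, φ') ∈ T.graph :=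
  ⟨T ⟨φ, (hE.mem_domain_iff φ).2 h⟩, T.mem_graph ⟨φ, (hE.mem_domain_iff φ).2 h⟩⟩

theorem exists_mem_graph_Icc (hE : E.IsSpectralMeasure T) (a b : ℝ) (φ : K) :
    ∃ φ', (E.effect (Set.Icc a b) φ, φ') ∈ T.graph := by
  refine hE.exists_mem_graph ?_
  rw [hE.isProjectionValued.measure_effect measurableSet_Icc]
  exact (continuous_pow 2).continuousOn.integrableOn_compact isCompact_Icc

/-- The expectations `⟨χ, T χ⟩` are real, being integrals of a real function; polarizing with `φ +
ψ` and `φ + iψ` gives symmetry. -/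
theorem inner_symm (hE : E.IsSpectralMeasure T) {φ φ' ψ ψ' : K} (hφ : (φ, φ') ∈ T.graph)
    (hψ : (ψ, ψ') ∈ T.graph) : ⟪φ, ψ'⟫_ℂ = ⟪φ', ψ⟫_ℂ := by
  have key : ∀ χ χ' : K, (χ, χ') ∈ T.graph → ⟪χ, χ'⟫_ℂ = ⟪χ', χ⟫_ℂ := fun χ χ' h => by
    rw [← inner_conj_symm χ' χ, hE.inner_eq_of_mem_graph h, Complex.conj_ofReal]
  have h0 := key _ _ hφ
  have h1 := key _ _ hψ
  have h2 := key _ _ (T.graph.add_mem hφ hψ)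
  have h3 := key _ _ (T.graph.add_mem hφ (smul_mem_graph Complex.I hψ))
  simp only [inner_add_left, inner_add_right, inner_smul_left, inner_smul_right,
    Complex.conj_I] at h2 h3
  have h4 : ⟪φ, ψ'⟫_ℂ + ⟪ψ, φ'⟫_ℂ = ⟪φ', ψ⟫_ℂ + ⟪ψ', φ⟫_ℂ := by linear_combination h2 - h0 - h1
  have h5 : ⟪φ, ψ'⟫_ℂ - ⟪ψ, φ'⟫_ℂ = ⟪φ', ψ⟫_ℂ - ⟪ψ', φ⟫_ℂ := by
    refine mul_left_cancel₀ Complex.I_ne_zero ?_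
    linear_combination h3 - h0 + Complex.I * Complex.I * h1
  linear_combination (h4 + h5) / 2

/-- By `measure_add` the first moment is additive on `φ + ψ`, which kills the sum of the two cross
terms. Replacing `ψ` by `iψ` kills their difference. -/
theorem inner_eq_zero (hE : E.IsSpectralMeasure T) {A : Set ℝ} (hA : MeasurableSet A)
    {φ φ' ψ ψ' : K} (hφ : (φ, φ') ∈ T.graph) (hψ : (ψ, ψ') ∈ T.graph)
    (h1 : E.effect A φ = φ) (h2 : E.effect A ψ = 0) : ⟪φ, ψ'⟫_ℂ = 0 ∧ ⟪ψ, φ'⟫_ℂ = 0 := by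
  have key : ∀ χ χ' : K, (χ, χ') ∈ T.graph → E.effect A χ = 0 →
      ⟪φ, χ'⟫_ℂ + ⟪χ, φ'⟫_ℂ = 0 := fun χ χ' hχ h3 => by
    have h4 := hE.inner_eq_of_mem_graph (T.graph.add_mem hφ hχ)
    have h5 := hE.isProjectionValued.measure_add hA h1 h3
    simp only [h5] at h4
    rw [integral_add_measure (hE.integrable_id hφ) (hE.integrable_id hχ)] at h4
    simp only [inner_add_left, inner_add_right, Complex.ofReal_add,
      ← hE.inner_eq_of_mem_graph hφ, ← hE.inner_eq_of_mem_graph hχ] at h4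
    linear_combination h4
  have h3 := key _ _ hψ h2
  have h4 := key _ _ (smul_mem_graph Complex.I hψ) (by simp [h2])
  simp only [inner_smul_left, inner_smul_right, Complex.conj_I] at h4
  have h5 : ⟪φ, ψ'⟫_ℂ - ⟪ψ, φ'⟫_ℂ = 0 :=
    mul_left_cancel₀ Complex.I_ne_zero (by linear_combination h4)
  exact ⟨by linear_combination (h3 + h5) / 2, by linear_combination (h3 - h5) / 2⟩

/-- This is density of the domain: the truncations `E [-n, n] η` lie in it, so orthogonality to the
domain leaves the measure of `η` with no mass on any `[-n, n]`. -/
theorem eq_zero_of_forall_inner (hE : E.IsSpectralMeasure T) {η : K}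
    (h : ∀ φ φ', (φ, φ') ∈ T.graph → ⟪φ, η⟫_ℂ = 0) : η = 0 := by
  have h0 : ∀ n : ℕ, E.measure η (Set.Icc (-(n : ℝ)) n) = 0 := fun n => by
    obtain ⟨φ', hφ'⟩ := hE.exists_mem_graph_Icc (-(n : ℝ)) n η
    have h1 := h _ _ hφ'
    rw [← E.inner_effect_comm] at h1
    rw [measure_apply _ _ measurableSet_Icc, h1]
    simp
  have hU : (⋃ n : ℕ, Set.Icc (-(n : ℝ)) n) = Set.univ := by
    refine Set.eq_univ_of_forall fun x => ?_
    obtain ⟨n, hn⟩ := exists_nat_ge |x|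
    exact Set.mem_iUnion.2 ⟨n, abs_le.1 hn⟩
  have h2 := measure_iUnion_null h0
  rw [hU, E.measure_univ, ENNReal.ofReal_eq_zero] at h2
  exact norm_eq_zero.1 (pow_eq_zero_iff two_ne_zero |>.1 (le_antisymm h2 (by positivity)))

/-- The spectral projections reduce the operator. -/
theorem effect_mem_graph (hE : E.IsSpectralMeasure T) {A : Set ℝ} (hA : MeasurableSet A)
    {ψ ψ' : K} (hψ : (ψ, ψ') ∈ T.graph) : (E.effect A ψ, E.effect A ψ') ∈ T.graph := by
  have hp := hE.isProjectionValued
  -- The measure of a projected vector is a restriction of the original one, so its second moment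
  -- stays finite.
  have hdom : ∀ {φ φ' : K}, (φ, φ') ∈ T.graph → ∃ η, (E.effect A φ, η) ∈ T.graph := by
    intro φ φ' hφ
    refine hE.exists_mem_graph ?_
    rw [hp.measure_effect hA]
    exact (hE.integrable_sq hφ).restrict
  obtain ⟨η, hη⟩ := hdom hψ
  suffices η - E.effect A ψ' = 0 by rwa [sub_eq_zero.1 this] at hη
  -- Write `P` for the projection and test against `φ` in the dense domain. Absence of cross terms
  -- gives `⟨φ, T P ψ⟩ = ⟨P φ, T P ψ⟩ = ⟨P φ, T ψ⟩`.
  refine hE.eq_zero_of_forall_inner fun φ φ' hφ => ?_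
  obtain ⟨ξ, hξ⟩ := hdom hφ
  have hz : ∀ χ, E.effect A (χ - E.effect A χ) = 0 := fun χ => by
    rw [map_sub, hp.effect_apply_self hA, sub_self]
  have h1 := (hE.inner_eq_zero hA hη (T.graph.sub_mem hφ hξ) (hp.effect_apply_self hA ψ)
    (hz φ)).2
  have h2 := (hE.inner_eq_zero hA hξ (T.graph.sub_mem hψ hη) (hp.effect_apply_self hA φ)
    (hz ψ)).1
  simp only [inner_sub_left, inner_sub_right] at h1 h2
  rw [inner_sub_right, E.inner_effect_comm]
  linear_combination h1 - h2

theorem effect_apply_eq (hE : E.IsSpectralMeasure T) {A : Set ℝ} (hA : MeasurableSet A)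
    {ψ ψ' : K} (hψ : (ψ, ψ') ∈ T.graph) (h : E.effect A ψ = ψ) : E.effect A ψ' = ψ' := by
  have h1 := hE.effect_mem_graph hA hψ
  exact T.mem_graph_snd_inj' h1 hψ h

theorem ae_mem (hE : E.IsSpectralMeasure T) {A : Set ℝ} (hA : MeasurableSet A) {ψ : K}
    (h : E.effect A ψ = ψ) : ∀ᵐ x ∂(E.measure ψ), x ∈ A := by
  rw [← h, hE.isProjectionValued.measure_effect hA]
  exact ae_restrict_mem hA

theorem inner_sub_smul (hE : E.IsSpectralMeasure T) {ψ ψ' : K} (hψ : (ψ, ψ') ∈ T.graph) (m : ℝ) :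
    ⟪ψ, ψ' - (m : ℂ) • ψ⟫_ℂ = ((∫ x : ℝ, (x - m) ∂(E.measure ψ) : ℝ) : ℂ) := by
  rw [inner_sub_right, inner_smul_right, hE.inner_eq_of_mem_graph hψ,
    integral_sub (hE.integrable_id hψ) (integrable_const m), integral_const,
    E.measureReal_univ, inner_self_eq_norm_sq_to_K]
  simp
  ring

/-- On the spectral subspace of `[m - r, m + r]` the quadratic form of `T - m` is bounded by `r`. As
`T` is symmetric and preserves this subspace, the form bound becomes a norm bound by polarization.
-/
theorem norm_sub_smul_le (hE : E.IsSpectralMeasure T) {m r : ℝ} {ψ ψ' : K}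
    (hψ : (ψ, ψ') ∈ T.graph) (h : E.effect (Set.Icc (m - r) (m + r)) ψ = ψ) :
    ‖ψ' - (m : ℂ) • ψ‖ ≤ r * ‖ψ‖ := by
  set χ := ψ' - (m : ℂ) • ψ with hχ
  have hχA : E.effect (Set.Icc (m - r) (m + r)) χ = χ := by
    rw [hχ, map_sub, map_smul, h, hE.effect_apply_eq measurableSet_Icc hψ h]
  obtain ⟨χ', hχ'⟩ := hE.exists_mem_graph_Icc (m - r) (m + r) χ
  rw [hχA] at hχ'
  have hB : ∀ f f' : K, (f, f') ∈ T.graph → E.effect (Set.Icc (m - r) (m + r)) f = f →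
      |(⟪f, f' - (m : ℂ) • f⟫_ℂ).re| ≤ r * ‖f‖ ^ 2 := fun f f' hf hfA => by
    rw [hE.inner_sub_smul hf, Complex.ofReal_re, ← E.measureReal_univ f, ← Real.norm_eq_abs]
    refine norm_integral_le_of_norm_le_const ?_
    filter_upwards [hE.ae_mem measurableSet_Icc hfA] with x hx
    rw [Real.norm_eq_abs, abs_le]
    constructor <;> linarith [hx.1, hx.2]
  -- With `χ = (T - m) ψ`, the forms at `ψ + t χ` and `ψ - t χ` differ by `4 t ‖χ‖²`, while the
  -- parallelogram law bounds the difference by `2 r (‖ψ‖² + t² ‖χ‖²)`.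
  have hpos : ∀ t : ℝ, 2 * t * ‖χ‖ ^ 2 ≤ r * (‖ψ‖ ^ 2 + t ^ 2 * ‖χ‖ ^ 2) := fun t => by
    have h1 := hB _ _ (T.graph.add_mem hψ (smul_mem_graph (t : ℂ) hχ'))
      (by simp only [map_add, map_smul, h, hχA])
    have h2 := hB _ _ (T.graph.sub_mem hψ (smul_mem_graph (t : ℂ) hχ'))
      (by simp only [map_sub, map_smul, h, hχA])
    have h3 := parallelogram_law_with_norm ℂ ψ ((t : ℂ) • χ)
    have h4 : ⟪ψ + (t : ℂ) • χ, ψ' + (t : ℂ) • χ' - (m : ℂ) • (ψ + (t : ℂ) • χ)⟫_ℂ -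
        ⟪ψ - (t : ℂ) • χ, ψ' - (t : ℂ) • χ' - (m : ℂ) • (ψ - (t : ℂ) • χ)⟫_ℂ =
        2 * t * (⟪χ, χ⟫_ℂ + ⟪χ, χ⟫_ℂ) := by
      have e1 : ⟪χ, χ⟫_ℂ = ⟪χ, ψ'⟫_ℂ - m * ⟪χ, ψ⟫_ℂ := by
        nth_rewrite 2 [hχ]
        rw [inner_sub_right, inner_smul_right]
      have e2 : ⟪χ, χ⟫_ℂ = ⟪ψ, χ'⟫_ℂ - m * ⟪ψ, χ⟫_ℂ := by
        nth_rewrite 1 [hχ]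
        rw [inner_sub_left, inner_smul_left, ← hE.inner_symm hψ hχ', Complex.conj_ofReal]
      simp only [inner_add_left, inner_add_right, inner_sub_left, inner_sub_right,
        inner_smul_left, inner_smul_right, Complex.conj_ofReal]
      linear_combination -2 * t * e1 - 2 * t * e2
    have h5 := congrArg Complex.re h4
    rw [inner_self_eq_norm_sq_to_K, Complex.sub_re] at h5
    have h6 : (2 * (t : ℂ) * ((‖χ‖ : ℂ) ^ 2 + (‖χ‖ : ℂ) ^ 2)).re = 4 * t * ‖χ‖ ^ 2 := by
      norm_cast
      ring
    have h7 : ‖(t : ℂ) • χ‖ ^ 2 = t ^ 2 * ‖χ‖ ^ 2 := by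
      rw [norm_smul, mul_pow, Complex.norm_real, Real.norm_eq_abs, sq_abs]
    have h8 := h5.trans h6
    have h9 := abs_le.1 h1
    have h10 := abs_le.1 h2
    have h11 : r * ‖ψ + (t : ℂ) • χ‖ ^ 2 + r * ‖ψ - (t : ℂ) • χ‖ ^ 2 =
        2 * r * (‖ψ‖ ^ 2 + t ^ 2 * ‖χ‖ ^ 2) := by
      rw [← h7]; linear_combination r * h3
    linarith [h9.2, h10.1]
  rcases eq_or_ne ψ 0 with h0 | h0
  · have : ψ' = 0 := by
      rw [h0] at hψ
      exact T.graph_fst_eq_zero_snd hψ rfl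
    simp [hχ, this, h0]
  rcases eq_or_ne χ 0 with hc | hc
  · rw [hc, norm_zero]
    have h1 := (abs_nonneg _).trans (hB _ _ hψ h)
    have : 0 < ‖ψ‖ := norm_pos_iff.2 h0
    have : 0 ≤ r := by
      by_contra hr
      nlinarith [pow_pos this 2]
    positivity
  have hx : 0 < ‖χ‖ := norm_pos_iff.2 hc
  have hy : 0 < ‖ψ‖ := norm_pos_iff.2 h0
  -- This value of `t` balances the two terms on the right of `hpos`.
  have h1 := hpos (‖ψ‖ / ‖χ‖)
  have h2 : 2 * (‖ψ‖ / ‖χ‖) * ‖χ‖ ^ 2 = 2 * ‖ψ‖ * ‖χ‖ := by field_simp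
  have h3 : r * (‖ψ‖ ^ 2 + (‖ψ‖ / ‖χ‖) ^ 2 * ‖χ‖ ^ 2) = 2 * ‖ψ‖ * (r * ‖ψ‖) := by
    field_simp
    ring
  rw [h2, h3] at h1
  exact le_of_mul_le_mul_left h1 (by positivity)

/-- On the spectral subspace of `[c, ∞)` the first moment gives `⟨ψ, (T - m) ψ⟩ ≥ (c - m) ‖ψ‖²`;
Cauchy–Schwarz does the rest. -/
theorem le_norm_sub_smul (hE : E.IsSpectralMeasure T) {m c : ℝ} {ψ ψ' : K}
    (hψ : (ψ, ψ') ∈ T.graph) (h : E.effect (Set.Ici c) ψ = ψ) :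
    (c - m) * ‖ψ‖ ≤ ‖ψ' - (m : ℂ) • ψ‖ := by
  rcases eq_or_ne ψ 0 with h0 | h0
  · simp [h0]
  have h1 : (c - m) * ‖ψ‖ ^ 2 ≤ ∫ x : ℝ, (x - m) ∂(E.measure ψ) := by
    rw [← E.measureReal_univ ψ, mul_comm, ← smul_eq_mul, ← integral_const]
    refine integral_mono_ae (integrable_const _)
      ((hE.integrable_id hψ).sub (integrable_const m)) ?_
    filter_upwards [hE.ae_mem measurableSet_Ici h] with x hx
    have : c ≤ x := hx
    simpa using this
  have h2 : ∫ x : ℝ, (x - m) ∂(E.measure ψ) ≤ ‖ψ‖ * ‖ψ' - (m : ℂ) • ψ‖ := by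
    refine le_trans ?_ (norm_inner_le_norm (𝕜 := ℂ) ψ _)
    rw [hE.inner_sub_smul hψ, Complex.norm_real]
    exact le_abs_self _
  refine le_of_mul_le_mul_left ?_ (norm_pos_iff.2 h0)
  linarith

/-- Each application of `T - m` stays in the `E`-subspace and gains at most a factor `r`, whereas
after projecting with `F`, which commutes with `T`, it gains at least `c - m`. The induction
therefore passes from `ψ` to `(T - m) ψ`. -/
theorem pow_mul_norm_le (hE : E.IsSpectralMeasure T) (hF : F.IsSpectralMeasure T) {m r c : ℝ}
    (hr : 0 ≤ r) (hc : m + r < c) (n : ℕ) (ψ : K)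
    (h : E.effect (Set.Icc (m - r) (m + r)) ψ = ψ) :
    (c - m) ^ n * ‖F.effect (Set.Ici c) ψ‖ ≤ r ^ n * (‖F.effect (Set.Ici c)‖ * ‖ψ‖) := by
  induction n generalizing ψ with
  | zero => simpa using ContinuousLinearMap.le_opNorm _ _
  | succ n ih =>
    obtain ⟨ψ', hψ'⟩ := hE.exists_mem_graph_Icc (m - r) (m + r) ψ
    rw [h] at hψ'
    have h1 := ih (ψ' - (m : ℂ) • ψ) (by
      rw [map_sub, map_smul, h, hE.effect_apply_eq measurableSet_Icc hψ' h])
    have h2 := hF.le_norm_sub_smul (m := m) (hF.effect_mem_graph measurableSet_Ici hψ')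
      (hF.isProjectionValued.effect_apply_self (measurableSet_Ici (a := c)) ψ)
    have h3 := hE.norm_sub_smul_le hψ' h
    rw [map_sub, map_smul] at h1
    calc (c - m) ^ (n + 1) * ‖F.effect (Set.Ici c) ψ‖
        = (c - m) ^ n * ((c - m) * ‖F.effect (Set.Ici c) ψ‖) := by ring
      _ ≤ (c - m) ^ n * ‖F.effect (Set.Ici c) ψ' - (m : ℂ) • F.effect (Set.Ici c) ψ‖ := by
        have : 0 ≤ c - m := by linarith
        gcongr
      _ ≤ r ^ n * (‖F.effect (Set.Ici c)‖ * ‖ψ' - (m : ℂ) • ψ‖) := h1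
      _ ≤ r ^ n * (‖F.effect (Set.Ici c)‖ * (r * ‖ψ‖)) := by gcongr
      _ = _ := by ring

theorem effect_Ici_effect_Icc (hE : E.IsSpectralMeasure T) (hF : F.IsSpectralMeasure T)
    {a b c : ℝ} (hab : a ≤ b) (hbc : b < c) (ψ : K) :
    F.effect (Set.Ici c) (E.effect (Set.Icc a b) ψ) = 0 := by
  obtain ⟨m, r, hr, rfl, rfl⟩ : ∃ m r : ℝ, 0 ≤ r ∧ m - r = a ∧ m + r = b :=
    ⟨(a + b) / 2, (b - a) / 2, by linarith, by ring, by ring⟩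
  set χ := E.effect (Set.Icc (m - r) (m + r)) ψ
  have h := fun n => hE.pow_mul_norm_le hF hr hbc n χ
    (hE.isProjectionValued.effect_apply_self measurableSet_Icc ψ)
  -- The ratio `r / (c - m)` is below one, so its powers force the projected vector to vanish.
  have hcm : 0 < c - m := by linarith
  have h1 : ∀ n : ℕ, ‖F.effect (Set.Ici c) χ‖ ≤
      (r / (c - m)) ^ n * (‖F.effect (Set.Ici c)‖ * ‖χ‖) := fun n => by
    rw [div_pow, div_mul_eq_mul_div, le_div_iff₀ (by positivity), mul_comm]
    exact h n
  have h2 := (tendsto_pow_atTop_nhds_zero_of_lt_one (div_nonneg hr hcm.le)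
    ((div_lt_one hcm).2 (by linarith))).mul_const (‖F.effect (Set.Ici c)‖ * ‖χ‖)
  rw [zero_mul] at h2
  exact norm_le_zero_iff.1 (ge_of_tendsto' h2 h1)

theorem effect_Ici_effect_Ici (hE : E.IsSpectralMeasure T) (hF : F.IsSpectralMeasure T)
    (c : ℝ) (ψ : K) : E.effect (Set.Ici c) (F.effect (Set.Ici c) ψ) = F.effect (Set.Ici c) ψ := by
  set η := F.effect (Set.Ici c) ψ with hη
  -- These compact intervals exhaust `(-∞, c)` while staying strictly below `c`, as
  -- `effect_Ici_effect_Icc` requires; the lower end `c - 1 - n` keeps them nonempty.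
  have h0 : ∀ n : ℕ, E.measure η (Set.Icc (c - 1 - n) (c - 1 / (n + 1))) = 0 := fun n => by
    have h1 : (1 : ℝ) / (n + 1) ≤ 1 := by
      rw [div_le_one (by positivity)]; linarith [(n.cast_nonneg : (0 : ℝ) ≤ n)]
    have h2 : (0 : ℝ) < 1 / (n + 1) := by positivity
    have := hE.effect_Ici_effect_Icc hF (a := c - 1 - n) (b := c - 1 / (n + 1)) (c := c)
      (by linarith [(n.cast_nonneg : (0 : ℝ) ≤ n)]) (by linarith) η
    rw [measure_apply _ _ measurableSet_Icc]
    nth_rewrite 1 [hη]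
    rw [← F.inner_effect_comm, this]
    simp
  have hU : (⋃ n : ℕ, Set.Icc (c - 1 - n) (c - 1 / ((n : ℝ) + 1))) = (Set.Ici c)ᶜ := by
    ext x
    simp only [Set.mem_iUnion, Set.mem_Icc, Set.mem_compl_iff, Set.mem_Ici, not_le]
    constructor
    · rintro ⟨n, -, h⟩
      have h2 : (0 : ℝ) < 1 / (n + 1) := by positivity
      linarith
    · intro hx
      obtain ⟨n, hn⟩ := exists_nat_ge (max (c - 1 - x) (1 / (c - x)))
      have h1 := (le_max_left _ _).trans hn
      have h2 := (le_max_right _ _).trans hn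
      refine ⟨n, by linarith, ?_⟩
      have h3 : 1 / ((n : ℝ) + 1) ≤ c - x := by
        rw [div_le_iff₀ (by positivity)]
        rw [div_le_iff₀ (by linarith)] at h2
        nlinarith
      linarith
  have h2 := measure_iUnion_null h0
  rw [hU] at h2
  have h3 := hE.isProjectionValued.effect_eq_zero_of_measure measurableSet_Ici.compl h2
  rw [E.effect_compl measurableSet_Ici] at h3
  exact (sub_eq_zero.1 h3).symm

/-- An operator has at most one spectral measure. -/
theorem unique (hE : E.IsSpectralMeasure T) (hF : F.IsSpectralMeasure T) : E = F := by
  refine ext_of_generateFrom (Set.range Set.Ici)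
    (BorelSpace.measurable_eq.trans (borel_eq_generateFrom_Ici ℝ)) isPiSystem_Ici ?_
  rintro _ ⟨c, rfl⟩
  ext ψ
  refine ext_inner_left ℂ fun φ => ?_
  -- Each half-line projection dominates the other, so taking adjoints makes them equal.
  rw [← hE.effect_Ici_effect_Ici hF, E.inner_effect_comm, E.inner_effect_comm,
    F.inner_effect_comm, hF.effect_Ici_effect_Ici hE]

end IsSpectralMeasure

end Observable

/-! ### Multiplication operators -/

section Multiplication

theorem norm_indicator_one_le {α : Type*} (A : Set α) (x : α) : ‖A.indicator (1 : α → ℂ) x‖ ≤ 1 := by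
  by_cases h : x ∈ A <;> simp [h]

variable {α : Type*} [MeasurableSpace α] {μ : Measure α}

theorem memLp_mul {m : α → ℂ} (hm : Measurable m) (hb : ∀ x, ‖m x‖ ≤ 1) (f : Lp ℂ 2 μ) :
    MemLp (fun x => m x * f x) 2 μ := by
  refine (Lp.memLp f).of_le (hm.aestronglyMeasurable.mul (Lp.aestronglyMeasurable f))
    (Filter.Eventually.of_forall fun x => ?_)
  rw [norm_mul]
  exact mul_le_of_le_one_left (norm_nonneg _) (hb x)

/-- Multiplication by a measurable function bounded by one. -/
def mulOp (m : α → ℂ) (hm : Measurable m) (hb : ∀ x, ‖m x‖ ≤ 1) : Lp ℂ 2 μ →L[ℂ] Lp ℂ 2 μ :=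
  LinearMap.mkContinuous
    { toFun := fun f => (memLp_mul hm hb f).toLp _
      map_add' := fun f g => by
        ext1
        filter_upwards [(memLp_mul hm hb (f + g)).coeFn_toLp, Lp.coeFn_add f g,
          Lp.coeFn_add ((memLp_mul hm hb f).toLp _) ((memLp_mul hm hb g).toLp _),
          (memLp_mul hm hb f).coeFn_toLp, (memLp_mul hm hb g).coeFn_toLp] with x h1 h2 h3 h4 h5
        rw [h1, h3, Pi.add_apply, h4, h5, h2, Pi.add_apply, mul_add]
      map_smul' := fun c f => by
        ext1
        filter_upwards [(memLp_mul hm hb (c • f)).coeFn_toLp, Lp.coeFn_smul c f,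
          Lp.coeFn_smul c ((memLp_mul hm hb f).toLp _),
          (memLp_mul hm hb f).coeFn_toLp] with x h1 h2 h3 h4
        rw [h1, RingHom.id_apply, h3, Pi.smul_apply, h4, h2, Pi.smul_apply, mul_smul_comm] }
    1 (fun f => by
      rw [one_mul]
      refine Lp.norm_le_norm_of_ae_le ?_
      filter_upwards [(memLp_mul hm hb f).coeFn_toLp] with x h
      simp only [LinearMap.coe_mk, AddHom.coe_mk]
      rw [h, norm_mul]
      exact mul_le_of_le_one_left (norm_nonneg _) (hb x))

theorem mulOp_coeFn {m : α → ℂ} (hm : Measurable m) (hb : ∀ x, ‖m x‖ ≤ 1) (f : Lp ℂ 2 μ) :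
    mulOp m hm hb f =ᵐ[μ] fun x => m x * f x :=
  (memLp_mul hm hb f).coeFn_toLp

/-- Multiplication by the indicator function of a measurable set. -/
def indicatorOp (μ : Measure α) {A : Set α} (hA : MeasurableSet A) : Lp ℂ 2 μ →L[ℂ] Lp ℂ 2 μ :=
  mulOp (A.indicator 1) (measurable_one.indicator hA) (norm_indicator_one_le A)

theorem indicatorOp_coeFn {A : Set α} (hA : MeasurableSet A) (f : Lp ℂ 2 μ) :
    indicatorOp μ hA f =ᵐ[μ] fun x => A.indicator 1 x * f x :=
  mulOp_coeFn _ _ f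

theorem inner_indicatorOp {A : Set α} (hA : MeasurableSet A) (φ ψ : Lp ℂ 2 μ) :
    ⟪φ, indicatorOp μ hA ψ⟫_ℂ = ∫ x in A, ⟪φ x, ψ x⟫_ℂ ∂μ := by
  rw [L2.inner_def, ← integral_indicator hA]
  refine integral_congr_ae ?_
  filter_upwards [indicatorOp_coeFn hA ψ] with x hx
  rw [hx]
  by_cases h : x ∈ A <;> simp [h]

theorem inner_indicatorOp_self {A : Set α} (hA : MeasurableSet A) (ψ : Lp ℂ 2 μ) :
    ⟪ψ, indicatorOp μ hA ψ⟫_ℂ = ((∫ x in A, ‖ψ x‖ ^ 2 ∂μ : ℝ) : ℂ) := by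
  rw [inner_indicatorOp, ← integral_complex_ofReal]
  congr 1
  ext x
  rw [inner_self_eq_norm_sq_to_K]
  norm_cast

variable (μ) in
/-- The canonical projection valued observable on `L²(μ)`: multiplication by indicator
functions. -/
def canonicalObservable : Observable (Lp ℂ 2 μ) α where
  effect A := open Classical in if hA : MeasurableSet A then indicatorOp μ hA else 0
  effect_of_not_measurableSet A hA := by simp [hA]
  isPositive A hA := by
    rw [ContinuousLinearMap.isPositive_iff_complex]
    intro ψ
    rw [dif_pos hA, ← inner_conj_symm, inner_indicatorOp_self, Complex.conj_ofReal]
    refine ⟨by simp, ?_⟩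
    simpa using integral_nonneg fun x => by positivity
  effect_univ := by
    rw [dif_pos MeasurableSet.univ]
    ext1 ψ
    ext1
    filter_upwards [indicatorOp_coeFn MeasurableSet.univ ψ] with x hx
    simpa using hx
  hasSum_inner A hA hd φ ψ := by
    simp only [hA, MeasurableSet.iUnion hA, dif_pos, inner_indicatorOp]
    exact hasSum_integral_iUnion hA hd (L2.integrable_inner φ ψ).integrableOn

theorem canonicalObservable_effect {A : Set α} (hA : MeasurableSet A) :
    (canonicalObservable μ).effect A = indicatorOp μ hA :=
  dif_pos hA

theorem canonicalObservable_isProjectionValued : (canonicalObservable μ).IsProjectionValued :=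
  fun A hA => by
    rw [canonicalObservable_effect hA]
    ext1 ψ
    ext1
    rw [mul_apply_eq_comp]
    filter_upwards [indicatorOp_coeFn hA ψ, indicatorOp_coeFn hA (indicatorOp μ hA ψ)] with x h1 h2
    rw [h2, h1]
    by_cases h : x ∈ A <;> simp [h]

theorem canonicalObservable_measure (ψ : Lp ℂ 2 μ) :
    (canonicalObservable μ).measure ψ = μ.withDensity fun x => ENNReal.ofReal (‖ψ x‖ ^ 2) := by
  ext A hA
  rw [Observable.measure_apply _ _ hA, canonicalObservable_effect hA, inner_indicatorOp_self,
    Complex.ofReal_re, withDensity_apply _ hA, ofReal_integral_eq_lintegral_ofReal]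
  · exact ((memLp_two_iff_integrable_sq_norm (Lp.aestronglyMeasurable ψ)).1 (Lp.memLp ψ)).restrict
  · exact Filter.Eventually.of_forall fun x => by positivity

theorem measurable_density (ψ : Lp ℂ 2 μ) :
    Measurable fun x => ENNReal.ofReal (‖ψ x‖ ^ 2) :=
  ((Lp.stronglyMeasurable ψ).measurable.norm.pow_const 2).ennreal_ofReal

theorem integrable_canonicalObservable_measure (ψ : Lp ℂ 2 μ) (g : α → ℝ) :
    Integrable g ((canonicalObservable μ).measure ψ) ↔
      Integrable (fun x => ‖ψ x‖ ^ 2 * g x) μ := by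
  rw [canonicalObservable_measure, integrable_withDensity_iff_integrable_smul'
    (measurable_density ψ) (Filter.Eventually.of_forall fun x => ENNReal.ofReal_lt_top)]
  simp only [ENNReal.toReal_ofReal (sq_nonneg _), smul_eq_mul]

theorem integral_canonicalObservable_measure (ψ : Lp ℂ 2 μ) (g : α → ℝ) :
    ∫ x, g x ∂((canonicalObservable μ).measure ψ) = ∫ x, ‖ψ x‖ ^ 2 * g x ∂μ := by
  rw [canonicalObservable_measure, integral_withDensity_eq_integral_toReal_smul
    (measurable_density ψ) (Filter.Eventually.of_forall fun x => ENNReal.ofReal_lt_top)]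
  simp only [ENNReal.toReal_ofReal (sq_nonneg _), smul_eq_mul]

end Multiplication

/-! ### Tensor products of operators -/

/-- Linear combinations of product vectors are dense in `L²(ℝ²)`, so by continuity operator
identities need checking only on product vectors. -/
theorem clm_ext_tprod {M : Type*} [NormedAddCommGroup M] [NormedSpace ℂ M] {S T : H₂ →L[ℂ] M}
    (h : ∀ f g, S (tprod f g) = T (tprod f g)) : S = T := by
  refine DFunLike.coe_injective (denseRange_tensorEmb.equalizer S.continuous T.continuous ?_)
  ext x
  simp only [Function.comp_apply]
  induction x with
  | zero => simp
  | add a b ha hb => simp only [map_add, ha, hb]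
  | tmul f g => exact h f g

theorem tensorOp_comp (S T S' T' : H →L[ℂ] H) :
    tensorOp S T ∘L tensorOp S' T' = tensorOp (S ∘L S') (T ∘L T') :=
  clm_ext_tprod fun f g => by simp [tensorOp_tprod]

theorem tensorOp_one : tensorOp 1 1 = 1 :=
  clm_ext_tprod fun f g => by simp [tensorOp_tprod]

theorem tensorOp_adjoint (S T : H →L[ℂ] H) :
    ContinuousLinearMap.adjoint (tensorOp S T) =
      tensorOp (ContinuousLinearMap.adjoint S) (ContinuousLinearMap.adjoint T) := by
  refine clm_ext_tprod fun f g => ext_inner_left ℂ fun Φ => ?_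
  rw [tensorOp_tprod, ContinuousLinearMap.adjoint_inner_right]
  have : (innerSL ℂ (tprod f g)) ∘L tensorOp S T = innerSL ℂ
      (tprod (ContinuousLinearMap.adjoint S f) (ContinuousLinearMap.adjoint T g)) :=
    clm_ext_tprod fun f' g' => by
      simp [tensorOp_tprod, inner_tprod, ContinuousLinearMap.adjoint_inner_left]
  have h := congrArg (starRingEnd ℂ) (DFunLike.congr_fun this Φ)
  simpa using h

theorem norm_tprod (f g : H) : ‖tprod f g‖ = ‖f‖ * ‖g‖ := by
  have h := inner_tprod f g f g
  rw [inner_self_eq_norm_sq_to_K, inner_self_eq_norm_sq_to_K, inner_self_eq_norm_sq_to_K] at h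
  have h' : ‖tprod f g‖ ^ 2 = (‖f‖ * ‖g‖) ^ 2 := by
    rw [mul_pow]; exact_mod_cast h
  exact (pow_left_inj₀ (norm_nonneg _) (by positivity) two_ne_zero).1 h'

/-- The map `f ↦ f ⊗ g`. -/
def tprodLeft (g : H) : H →L[ℂ] H₂ :=
  LinearMap.mkContinuous (tprodₗ.flip g) ‖g‖ fun f => by
    rw [mul_comm]; exact (norm_tprod f g).le

/-- The map `g ↦ f ⊗ g`. -/
def tprodRight (f : H) : H →L[ℂ] H₂ :=
  LinearMap.mkContinuous (tprodₗ f) ‖f‖ fun g => (norm_tprod f g).le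

theorem clm_ext_hilbertBasis {ι K M : Type*} [NormedAddCommGroup K] [InnerProductSpace ℂ K]
    [NormedAddCommGroup M] [NormedSpace ℂ M] (e : HilbertBasis ι ℂ K) {S T : K →L[ℂ] M}
    (h : ∀ i, S (e i) = T (e i)) : S = T :=
  ContinuousLinearMap.ext_on (Submodule.dense_iff_topologicalClosure_eq_top.2 e.dense_span)
    (by rintro _ ⟨i, rfl⟩; exact h i)

/-- The product of two Hilbert bases is a Hilbert basis of the tensor product. -/
def tensorBasis {ι κ : Type*} (e : HilbertBasis ι ℂ H) (e' : HilbertBasis κ ℂ H) :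
    HilbertBasis (ι × κ) ℂ H₂ :=
  HilbertBasis.mkOfOrthogonalEqBot (v := fun k : ι × κ => tprod (e k.1) (e' k.2))
    (by
      classical
      rw [orthonormal_iff_ite]
      rintro ⟨i, j⟩ ⟨i', j'⟩
      rw [inner_tprod, orthonormal_iff_ite.1 e.orthonormal, orthonormal_iff_ite.1 e'.orthonormal]
      simp only [Prod.mk.injEq, ite_and]
      split_ifs <;> simp)
    (by
      rw [Submodule.eq_bot_iff]
      intro Φ hΦ
      rw [Submodule.mem_orthogonal'] at hΦ
      have h0 : ∀ i j, ⟪Φ, tprod (e i) (e' j)⟫_ℂ = 0 := fun i j =>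
        hΦ _ (Submodule.subset_span ⟨(i, j), rfl⟩)
      have h1 : ∀ f j, ⟪Φ, tprod f (e' j)⟫_ℂ = 0 := fun f j => by
        have : innerSL ℂ Φ ∘L tprodLeft (e' j) = 0 := clm_ext_hilbertBasis e fun i => h0 i j
        exact DFunLike.congr_fun this f
      have h2 : ∀ f g, ⟪Φ, tprod f g⟫_ℂ = 0 := fun f g => by
        have : innerSL ℂ Φ ∘L tprodRight f = 0 := clm_ext_hilbertBasis e' fun j => h1 f j
        exact DFunLike.congr_fun this g
      have h3 : innerSL ℂ Φ = 0 := clm_ext_tprod h2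
      exact inner_self_eq_zero.1 (DFunLike.congr_fun h3 Φ))

theorem tensorBasis_apply {ι κ : Type*} (e : HilbertBasis ι ℂ H) (e' : HilbertBasis κ ℂ H)
    (k : ι × κ) : tensorBasis e e' k = tprod (e k.1) (e' k.2) := by
  simp [tensorBasis]

theorem ae_fst {f g : ℝ → ℂ} (h : f =ᵐ[volume] g) :
    (fun z : ℝ × ℝ => f z.1) =ᵐ[volume] fun z => g z.1 :=
  (Measure.quasiMeasurePreserving_fst (μ := (volume : Measure ℝ))
    (ν := (volume : Measure ℝ))).ae_eq_comp h

theorem ae_snd {f g : ℝ → ℂ} (h : f =ᵐ[volume] g) :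
    (fun z : ℝ × ℝ => f z.2) =ᵐ[volume] fun z => g z.2 :=
  (Measure.quasiMeasurePreserving_snd (μ := (volume : Measure ℝ))
    (ν := (volume : Measure ℝ))).ae_eq_comp h

theorem tensorOp_mulOp_apply {m n : ℝ → ℂ} (hm : Measurable m) (hn : Measurable n)
    (hm1 : ∀ x, ‖m x‖ ≤ 1) (hn1 : ∀ x, ‖n x‖ ≤ 1) {k : ℝ × ℝ → ℂ} (hk : Measurable k)
    (hk1 : ∀ z, ‖k z‖ ≤ 1) (h : ∀ z, k z = m z.1 * n z.2) :
    tensorOp (mulOp m hm hm1) (mulOp n hn hn1) = mulOp k hk hk1 := by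
  refine clm_ext_tprod fun f g => ?_
  rw [tensorOp_tprod]
  ext1
  filter_upwards [tprod_coeFn f g, tprod_coeFn (mulOp m hm hm1 f) (mulOp n hn hn1 g),
    mulOp_coeFn hk hk1 (tprod f g), ae_fst (mulOp_coeFn hm hm1 f),
    ae_snd (mulOp_coeFn hn hn1 g)] with z h1 h2 h3 h4 h5
  rw [h2, h3, h1, h4, h5, h]
  ring

theorem tensorOp_canonicalObservable {A B : Set ℝ} (hA : MeasurableSet A) (hB : MeasurableSet B) :
    tensorOp ((canonicalObservable volume).effect A) ((canonicalObservable volume).effect B) =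
      (canonicalObservable volume).effect (A ×ˢ B) := by
  rw [canonicalObservable_effect hA, canonicalObservable_effect hB,
    canonicalObservable_effect (hA.prod hB)]
  refine tensorOp_mulOp_apply _ _ _ _ _ _ fun z => ?_
  by_cases h1 : z.1 ∈ A <;> by_cases h2 : z.2 ∈ B <;> simp [Set.indicator, Set.mem_prod, h1, h2]

/-! ### Functions of temperate growth -/

theorem iteratedDeriv_cexp_I_mul_ofReal (n : ℕ) :
    (iteratedDeriv n fun t : ℝ => Complex.exp (Complex.I * t)) =
      fun t : ℝ => Complex.I ^ n * Complex.exp (Complex.I * t) := by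
  induction n with
  | zero => simp
  | succ n ih =>
    rw [iteratedDeriv_succ, ih]
    ext t
    have h : HasDerivAt (fun t : ℝ => Complex.exp (Complex.I * t))
        (Complex.exp (Complex.I * t) * (Complex.I * 1)) t :=
      (((hasDerivAt_id t).ofReal_comp).const_mul Complex.I).cexp
    rw [(h.const_mul (Complex.I ^ n)).deriv]
    ring

theorem hasTemperateGrowth_cexp_I_mul_ofReal :
    (fun t : ℝ => Complex.exp (Complex.I * t)).HasTemperateGrowth := by
  refine ⟨(contDiff_const.mul Complex.ofRealCLM.contDiff).cexp, fun n => ⟨0, 1, fun t => ?_⟩⟩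
  rw [norm_iteratedFDeriv_eq_norm_iteratedDeriv, iteratedDeriv_cexp_I_mul_ofReal, norm_mul,
    norm_pow, Complex.norm_I, one_pow, mul_comm Complex.I, Complex.norm_exp_ofReal_mul_I]
  simp

theorem hasTemperateGrowth_cexp_I_mul {g : ℝ → ℝ} (hg : g.HasTemperateGrowth) :
    (fun x => Complex.exp (Complex.I * g x)).HasTemperateGrowth :=
  hasTemperateGrowth_cexp_I_mul_ofReal.comp hg

theorem norm_cexp_I_mul (t : ℝ) : ‖Complex.exp (Complex.I * t)‖ = 1 := by
  rw [mul_comm, Complex.norm_exp_ofReal_mul_I]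

theorem ofReal_add_I_ne_zero (x : ℝ) : (x : ℂ) + Complex.I ≠ 0 := fun h => by
  simpa using congrArg Complex.im h

/-- `1/(x + i) = (x - i)(1 + x²)⁻¹`. It makes division by `x + i` preserve Schwartz functions, which
supplies the core in `le_closure_graph`. -/
theorem hasTemperateGrowth_inv_add_I :
    (fun x : ℝ => ((x : ℂ) + Complex.I)⁻¹).HasTemperateGrowth := by
  have h : (fun x : ℝ => ((x : ℂ) + Complex.I)⁻¹) =
      fun x : ℝ => ((x : ℂ) - Complex.I) * (((1 + ‖x‖ ^ 2) ^ (-1 : ℝ) : ℝ) : ℂ) := by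
    ext x
    have h0 : (1 : ℂ) + (x : ℂ) ^ 2 ≠ 0 := by
      have : (0 : ℝ) < 1 + x ^ 2 := by positivity
      exact_mod_cast this.ne'
    rw [Real.rpow_neg_one, Real.norm_eq_abs, sq_abs]
    push_cast
    field_simp [ofReal_add_I_ne_zero x]
    linear_combination Complex.I_sq
  rw [h]
  have h1 : (fun x : ℝ => (x : ℂ) - Complex.I).HasTemperateGrowth :=
    Function.Complex.hasTemperateGrowth_ofReal.sub (Function.HasTemperateGrowth.const _)
  exact h1.mul (Function.Complex.hasTemperateGrowth_ofReal.comp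
    (Function.hasTemperateGrowth_one_add_norm_sq_rpow ℝ (-1)))

theorem schwartzEmb_coeFn (f : 𝓢(ℝ, ℂ)) : schwartzEmb f =ᵐ[volume] f :=
  SchwartzMap.coeFn_toLp f 2 volume

theorem schwartzEmb_eq_mulOp {m : ℝ → ℂ} (hm : Measurable m) (hb : ∀ x, ‖m x‖ ≤ 1)
    {f g : 𝓢(ℝ, ℂ)} (h : ∀ x, g x = m x * f x) :
    schwartzEmb g = mulOp m hm hb (schwartzEmb f) := by
  ext1
  filter_upwards [schwartzEmb_coeFn f, schwartzEmb_coeFn g,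
    mulOp_coeFn hm hb (schwartzEmb f)] with x h1 h2 h3
  rw [h2, h3, h1, h]

theorem denseRange_schwartzEmb : DenseRange schwartzEmb :=
  SchwartzMap.denseRange_toLpCLM (E := ℝ) (F := ℂ) (p := 2) (μ := volume) ENNReal.ofNat_ne_top

theorem quadratureS_apply (θ : ℝ) (f : 𝓢(ℝ, ℂ)) (x : ℝ) :
    quadratureS θ f x = Real.cos θ * (x * f x) - Complex.I * Real.sin θ * deriv f x := by
  have hs : (Real.sqrt 2 : ℂ)⁻¹ * (Real.sqrt 2 : ℂ)⁻¹ = 1 / 2 := by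
    rw [← mul_inv, ← Complex.ofReal_mul, Real.mul_self_sqrt (by norm_num)]
    norm_num
  have h : quadratureS θ f x = (Real.sqrt 2 : ℂ)⁻¹ *
      (Complex.exp (Complex.I * θ) * ((Real.sqrt 2 : ℂ)⁻¹ * (posS f x - deriv f x)) +
        Complex.exp (-(Complex.I * θ)) * ((Real.sqrt 2 : ℂ)⁻¹ * (posS f x + deriv f x))) := rfl
  have h1 : Complex.exp (Complex.I * θ) = Complex.cos θ + Complex.sin θ * Complex.I := by
    rw [mul_comm, Complex.exp_mul_I]
  have h2 : Complex.exp (-(Complex.I * θ)) = Complex.cos θ - Complex.sin θ * Complex.I := by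
    rw [mul_comm, ← neg_mul, Complex.exp_mul_I, Complex.cos_neg, Complex.sin_neg]
    ring
  rw [h, posS_apply, h1, h2, Complex.ofReal_cos, Complex.ofReal_sin]
  linear_combination
    (2 * Complex.cos θ * (x * f x) - 2 * Complex.I * Complex.sin θ * deriv f x) * hs

/-! ### The graph of a quadrature -/

/-- The quadrature on the domain of Schwartz functions. -/
def schwartzQuadrature (θ : ℝ) : H →ₗ.[ℂ] H where
  domain := LinearMap.range schwartzEmb
  toFun := schwartzEmb ∘ₗ (quadratureS θ : 𝓢(ℝ, ℂ) →ₗ[ℂ] 𝓢(ℝ, ℂ)) ∘ₗ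
    (LinearEquiv.ofInjective schwartzEmb schwartzEmb_injective).symm.toLinearMap

theorem quadrature_eq (θ : ℝ) : quadrature θ = (schwartzQuadrature θ).closure := rfl

theorem mem_graph_schwartzQuadrature {θ : ℝ} {z : H × H} :
    z ∈ (schwartzQuadrature θ).graph ↔
      ∃ f, z = (schwartzEmb f, schwartzEmb (quadratureS θ f)) := by
  have key : ∀ f (h : schwartzEmb f ∈ LinearMap.range schwartzEmb),
      schwartzQuadrature θ ⟨schwartzEmb f, h⟩ = schwartzEmb (quadratureS θ f) := fun f h => by
    have : (LinearEquiv.ofInjective schwartzEmb schwartzEmb_injective).symm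
        ⟨schwartzEmb f, h⟩ = f := by
      rw [LinearEquiv.symm_apply_eq]
      rfl
    change schwartzEmb (quadratureS θ
      ((LinearEquiv.ofInjective schwartzEmb schwartzEmb_injective).symm ⟨schwartzEmb f, h⟩)) = _
    rw [this]
  rw [LinearPMap.mem_graph_iff]
  constructor
  · rintro ⟨⟨_, f, rfl⟩, h1, h2⟩
    exact ⟨f, Prod.ext h1.symm (h2.symm.trans (key f _))⟩
  · rintro ⟨f, rfl⟩
    exact ⟨⟨schwartzEmb f, f, rfl⟩, rfl, key f _⟩

theorem norm_ofReal_le_norm_add_I (x : ℝ) : ‖(x : ℂ)‖ ≤ ‖(x : ℂ) + Complex.I‖ := by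
  rw [Complex.norm_real, Real.norm_eq_abs]
  have := Complex.abs_re_le_norm ((x : ℂ) + Complex.I)
  simpa using this

theorem one_le_norm_add_I (x : ℝ) : 1 ≤ ‖(x : ℂ) + Complex.I‖ := by
  have := Complex.abs_im_le_norm ((x : ℂ) + Complex.I)
  simpa using this

/-- Multiplication by `1 / (x + i)`. -/
def resolventOp : H →L[ℂ] H :=
  mulOp (fun x : ℝ => ((x : ℂ) + Complex.I)⁻¹) (by fun_prop) fun x => by
    rw [norm_inv]; exact inv_le_one_of_one_le₀ (one_le_norm_add_I x)

/-- Multiplication by `x / (x + i)`. -/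
def posResolventOp : H →L[ℂ] H :=
  mulOp (fun x : ℝ => (x : ℂ) * ((x : ℂ) + Complex.I)⁻¹) (by fun_prop) fun x => by
    rw [norm_mul, norm_inv, ← div_eq_mul_inv]
    exact div_le_one_of_le₀ (norm_ofReal_le_norm_add_I x) (norm_nonneg _)

theorem posResolventOp_add (f : H) : posResolventOp f + Complex.I • resolventOp f = f := by
  ext1
  filter_upwards [Lp.coeFn_add (posResolventOp f) (Complex.I • resolventOp f),
    Lp.coeFn_smul Complex.I (resolventOp f), mulOp_coeFn _ _ f, mulOp_coeFn _ _ f]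
    with x h1 h2 h3 h4
  rw [h1, Pi.add_apply, h2, Pi.smul_apply, posResolventOp, h3, resolventOp, h4, smul_eq_mul]
  field_simp [ofReal_add_I_ne_zero x]

/-- Dividing by the nowhere vanishing `x + i` turns the unbounded relation `g = κ x f` into an
identity between bounded operators, so that its graph is visibly closed. -/
theorem resolventOp_eq_iff (κ : ℝ) (f g : H) :
    resolventOp g = (κ : ℂ) • posResolventOp f ↔ g =ᵐ[volume] fun x : ℝ => κ * x * f x := by
  have h1 : resolventOp g =ᵐ[volume] fun x : ℝ => ((x : ℂ) + Complex.I)⁻¹ * g x := mulOp_coeFn _ _ g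
  have h2 : (((κ : ℂ) • posResolventOp f : H) : ℝ → ℂ) =ᵐ[volume]
      fun x : ℝ => ((x : ℂ) + Complex.I)⁻¹ * (κ * x * f x) := by
    filter_upwards [Lp.coeFn_smul (κ : ℂ) (posResolventOp f), mulOp_coeFn _ _ f] with x h3 h4
    rw [h3, Pi.smul_apply, posResolventOp, h4, smul_eq_mul]
    ring
  rw [Lp.ext_iff]
  constructor
  · intro h
    filter_upwards [h, h1, h2] with x h3 h4 h5
    rw [h4, h5] at h3
    exact mul_left_cancel₀ (inv_ne_zero (ofReal_add_I_ne_zero x)) h3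
  · intro h
    filter_upwards [h, h1, h2] with x h3 h4 h5
    rw [h4, h5, h3]

/-- The unitary operator `V`, which acts on Schwartz functions by the bijection `S`, turns the
quadrature `Q_θ` into multiplication by `κ x`. -/
structure Diagonalizes (θ : ℝ) (V : H ≃ₗᵢ[ℂ] H) (κ : ℝ) (S : 𝓢(ℝ, ℂ) → 𝓢(ℝ, ℂ)) : Prop where
  ne_zero : κ ≠ 0
  surjective : Function.Surjective S
  map_schwartzEmb : ∀ f, V (schwartzEmb f) = schwartzEmb (S f)
  map_quadratureS : ∀ f x, S (quadratureS θ f) x = κ * x * S f x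

/-! ### The closed quadrature as a maximal multiplication operator -/

namespace Diagonalizes

variable {θ κ : ℝ} {V : H ≃ₗᵢ[ℂ] H} {S : 𝓢(ℝ, ℂ) → 𝓢(ℝ, ℂ)}

/-- The pairs `(ψ, η)` with `V η = κ x V ψ`. -/
def maximalGraph (V : H ≃ₗᵢ[ℂ] H) (κ : ℝ) : Submodule ℂ (H × H) :=
  LinearMap.ker ((resolventOp ∘L (V : H →L[ℂ] H) ∘L ContinuousLinearMap.snd ℂ H H -
    (κ : ℂ) • (posResolventOp ∘L (V : H →L[ℂ] H) ∘L ContinuousLinearMap.fst ℂ H H) :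
      H × H →L[ℂ] H) : H × H →ₗ[ℂ] H)

theorem mem_maximalGraph {ψ η : H} :
    (ψ, η) ∈ maximalGraph V κ ↔ resolventOp (V η) = (κ : ℂ) • posResolventOp (V ψ) := by
  rw [maximalGraph, LinearMap.mem_ker]
  exact sub_eq_zero

theorem mem_maximalGraph_iff_ae {ψ η : H} :
    (ψ, η) ∈ maximalGraph V κ ↔ V η =ᵐ[volume] fun x : ℝ => κ * x * V ψ x := by
  rw [mem_maximalGraph, resolventOp_eq_iff]

theorem graph_le (h : Diagonalizes θ V κ S) : (schwartzQuadrature θ).graph ≤ maximalGraph V κ := by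
  intro z hz
  obtain ⟨f, rfl⟩ := mem_graph_schwartzQuadrature.1 hz
  rw [mem_maximalGraph_iff_ae, h.map_schwartzEmb, h.map_schwartzEmb]
  filter_upwards [schwartzEmb_coeFn (S f), schwartzEmb_coeFn (S (quadratureS θ f))] with x h1 h2
  rw [h2, h1, h.map_quadratureS]

/-- Schwartz functions form a core: the map `Φ` below parametrizes the maximal graph continuously by
`u = (x + i) V ψ` and sends Schwartz `u` into the Schwartz graph, so density gives the rest. -/
theorem le_closure_graph (h : Diagonalizes θ V κ S) :
    maximalGraph V κ ≤ (schwartzQuadrature θ).graph.topologicalClosure := by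
  rintro ⟨ψ, η⟩ hz
  rw [mem_maximalGraph] at hz
  have hκ : (κ : ℂ) ≠ 0 := Complex.ofReal_ne_zero.2 h.ne_zero
  let Φ : H → H × H := fun u => (V.symm (resolventOp u), (κ : ℂ) • V.symm (posResolventOp u))
  have hΦ : Continuous Φ := by fun_prop
  have hmaps : Set.MapsTo Φ (Set.range schwartzEmb) (schwartzQuadrature θ).graph := by
    rintro _ ⟨f, rfl⟩
    obtain ⟨g, hg⟩ := h.surjective
      (SchwartzMap.smulLeftCLM ℂ (fun x : ℝ => ((x : ℂ) + Complex.I)⁻¹) f)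
    have hgx : ∀ x, S g x = ((x : ℂ) + Complex.I)⁻¹ * f x := fun x => by
      rw [hg, SchwartzMap.smulLeftCLM_apply_apply hasTemperateGrowth_inv_add_I, smul_eq_mul]
    refine mem_graph_schwartzQuadrature.2 ⟨g, Prod.ext ?_ ?_⟩
    · change V.symm _ = _
      rw [LinearIsometryEquiv.symm_apply_eq, h.map_schwartzEmb]
      exact (schwartzEmb_eq_mulOp _ _ hgx).symm
    · change (κ : ℂ) • V.symm _ = _
      rw [← map_smul, LinearIsometryEquiv.symm_apply_eq, h.map_schwartzEmb]
      ext1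
      filter_upwards [Lp.coeFn_smul (κ : ℂ) (posResolventOp (schwartzEmb f)),
        mulOp_coeFn _ _ (schwartzEmb f), schwartzEmb_coeFn f,
        schwartzEmb_coeFn (S (quadratureS θ g))] with x h1 h2 h3 h4
      rw [h1, Pi.smul_apply, posResolventOp, h2, h3, h4, h.map_quadratureS, hgx, smul_eq_mul]
      ring
  -- The parameter is `(x + i) V ψ`, written as `κ⁻¹ V η + i V ψ` because `V η = κ x V ψ`.
  have hmem := hmaps.closure hΦ (denseRange_schwartzEmb ((κ : ℂ)⁻¹ • V η + Complex.I • V ψ))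
  have heq : Φ ((κ : ℂ)⁻¹ • V η + Complex.I • V ψ) = (ψ, η) := by
    refine Prod.ext ?_ ?_
    · change V.symm _ = ψ
      rw [LinearIsometryEquiv.symm_apply_eq, map_add, map_smul, map_smul, hz, smul_smul,
        inv_mul_cancel₀ hκ, one_smul]
      exact posResolventOp_add _
    · change (κ : ℂ) • V.symm _ = η
      rw [← map_smul, LinearIsometryEquiv.symm_apply_eq, map_add, map_smul, map_smul, smul_add,
        smul_smul, mul_inv_cancel₀ hκ, one_smul, smul_comm, ← hz]
      exact posResolventOp_add _
  rw [heq] at hmem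
  exact hmem

theorem closure_graph (h : Diagonalizes θ V κ S) :
    (schwartzQuadrature θ).graph.topologicalClosure = maximalGraph V κ :=
  le_antisymm (Submodule.topologicalClosure_minimal _ h.graph_le
    (ContinuousLinearMap.isClosed_ker _)) h.le_closure_graph

/-- The maximal graph is single valued, since `V ψ = 0` forces `κ x V ψ = 0`. Without closability
`LinearPMap.closure` would return its default, the operator itself. -/
theorem isClosable (h : Diagonalizes θ V κ S) : (schwartzQuadrature θ).IsClosable := by
  refine ⟨(maximalGraph V κ).toLinearPMap, ?_⟩
  rw [Submodule.toLinearPMap_graph_eq, h.closure_graph]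
  rintro ⟨ψ, η⟩ hz (rfl : ψ = 0)
  rw [mem_maximalGraph_iff_ae, map_zero] at hz
  have : V η = 0 := by
    ext1
    filter_upwards [hz, Lp.coeFn_zero ℂ 2 (volume : Measure ℝ)] with x h1 h2
    rw [h1, h2]
    simp
  simpa using this

theorem graph_quadrature (h : Diagonalizes θ V κ S) :
    (quadrature θ).graph = maximalGraph V κ := by
  rw [quadrature_eq, ← h.isClosable.graph_closure_eq_closure_graph, h.closure_graph]

end Diagonalizes

theorem adjoint_comp_self (V : H ≃ₗᵢ[ℂ] H) :
    ContinuousLinearMap.adjoint (V : H →L[ℂ] H) ∘L (V : H →L[ℂ] H) = 1 := by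
  ext1 x
  refine ext_inner_left ℂ fun y => ?_
  simp

theorem self_comp_adjoint (V : H ≃ₗᵢ[ℂ] H) :
    (V : H →L[ℂ] H) ∘L ContinuousLinearMap.adjoint (V : H →L[ℂ] H) = 1 := by
  ext1 x
  obtain ⟨y, rfl⟩ := V.surjective x
  have := DFunLike.congr_fun (adjoint_comp_self V) y
  exact congrArg V this

/-- The observable `A ↦ V* 1_{κ x ∈ A} V`. -/
def diagonalObservable (V : H ≃ₗᵢ[ℂ] H) (κ : ℝ) : Observable H ℝ :=
  ((canonicalObservable volume).map (fun x => κ * x) (measurable_const_mul κ)).conj V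
    (adjoint_comp_self V)

theorem diagonalObservable_measure (V : H ≃ₗᵢ[ℂ] H) (κ : ℝ) (ψ : H) :
    (diagonalObservable V κ).measure ψ =
      ((canonicalObservable volume).measure (V ψ)).map fun x => κ * x := by
  rw [diagonalObservable, Observable.measure_conj, Observable.measure_map]
  rfl

/-- The measure of `ψ` is the image of `|V ψ|² dx` under `x ↦ κ x`. Its second moment is finite
exactly when `κ x V ψ` is in `L²`, which is the domain of the maximal multiplication operator. -/
theorem Diagonalizes.isSpectralMeasure {θ κ : ℝ} {V : H ≃ₗᵢ[ℂ] H} {S : 𝓢(ℝ, ℂ) → 𝓢(ℝ, ℂ)}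
    (h : Diagonalizes θ V κ S) : (diagonalObservable V κ).IsSpectralMeasure (quadrature θ) where
  isProjectionValued := (canonicalObservable_isProjectionValued.map _).conj _ _
    (self_comp_adjoint V)
  mem_domain_iff ψ := by
    have hm : AEStronglyMeasurable (fun x : ℝ => κ * x * V ψ x) volume :=
      (by fun_prop : Continuous fun x : ℝ => (κ * x : ℂ)).aestronglyMeasurable.mul
        (Lp.aestronglyMeasurable _)
    have h1 : Integrable (fun x : ℝ => x ^ 2) ((diagonalObservable V κ).measure ψ) ↔
        MemLp (fun x : ℝ => κ * x * V ψ x) 2 volume := by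
      rw [diagonalObservable_measure, integrable_map_measure (by fun_prop) (by fun_prop),
        integrable_canonicalObservable_measure, memLp_two_iff_integrable_sq_norm hm]
      refine integrable_congr (Filter.Eventually.of_forall fun x => ?_)
      simp only [Function.comp_apply, norm_mul, Complex.norm_real, Real.norm_eq_abs, mul_pow,
        sq_abs]
      ring
    rw [h1, LinearPMap.mem_domain_iff, h.graph_quadrature]
    simp only [mem_maximalGraph_iff_ae]
    constructor
    · rintro ⟨η, hη⟩
      exact (memLp_congr_ae hη).1 (Lp.memLp _)
    · intro hL
      refine ⟨V.symm (hL.toLp _), ?_⟩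
      rw [LinearIsometryEquiv.apply_symm_apply]
      exact hL.coeFn_toLp
  inner_eq ψ := by
    have hg := (quadrature θ).mem_graph ψ
    rw [h.graph_quadrature, mem_maximalGraph_iff_ae] at hg
    rw [diagonalObservable_measure, integral_map (by fun_prop) (by fun_prop),
      integral_canonicalObservable_measure, ← V.inner_map_map, L2.inner_def,
      ← integral_complex_ofReal]
    refine integral_congr_ae ?_
    filter_upwards [hg] with x hx
    rw [hx, RCLike.inner_apply]
    push_cast
    rw [← Complex.conj_mul']
    ring

/-! ### Diagonalization of the quadratures -/

/-- Multiplication by `e^{i g(x)}`. -/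
def phaseOp {α : Type*} [MeasurableSpace α] {μ : Measure α} (g : α → ℝ) (hg : Measurable g) :
    Lp ℂ 2 μ →L[ℂ] Lp ℂ 2 μ :=
  mulOp (fun x => Complex.exp (Complex.I * g x)) (by fun_prop) fun x => (norm_cexp_I_mul _).le

theorem phaseOp_coeFn {α : Type*} [MeasurableSpace α] {μ : Measure α} {g : α → ℝ}
    (hg : Measurable g) (f : Lp ℂ 2 μ) :
    phaseOp g hg f =ᵐ[μ] fun x => Complex.exp (Complex.I * g x) * f x :=
  mulOp_coeFn _ _ f

/-- Multiplication by `e^{i g(x)}` as a unitary operator. -/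
def phaseEquiv (g : ℝ → ℝ) (hg : Measurable g) : H ≃ₗᵢ[ℂ] H :=
  LinearIsometryEquiv.ofSurjective
    { toLinearMap := (phaseOp g hg : H →L[ℂ] H)
      norm_map' := fun f => by
        refine le_antisymm (Lp.norm_le_norm_of_ae_le ?_) (Lp.norm_le_norm_of_ae_le ?_) <;>
        · filter_upwards [phaseOp_coeFn hg f] with x hx
          rw [ContinuousLinearMap.coe_coe, hx, norm_mul, norm_cexp_I_mul, one_mul] }
    (fun f => by
      refine ⟨phaseOp (-g) hg.neg f, ?_⟩
      ext1
      refine (phaseOp_coeFn hg _).trans ?_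
      filter_upwards [phaseOp_coeFn hg.neg f] with x hx
      rw [hx, ← mul_assoc, ← Complex.exp_add]
      simp)

theorem phaseEquiv_schwartzEmb {g : ℝ → ℝ} (hg : Measurable g) {f f' : 𝓢(ℝ, ℂ)}
    (h : ∀ x, f' x = Complex.exp (Complex.I * g x) * f x) :
    phaseEquiv g hg (schwartzEmb f) = schwartzEmb f' := by
  symm
  exact schwartzEmb_eq_mulOp (by fun_prop) (fun x => (norm_cexp_I_mul _).le) h

theorem fourier_derivCLM (f : 𝓢(ℝ, ℂ)) (x : ℝ) :
    FourierTransform.fourier (SchwartzMap.derivCLM ℂ ℂ f) x =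
      2 * Real.pi * Complex.I * x * FourierTransform.fourier f x := by
  have h := Real.fourier_deriv f.integrable f.differentiable
    (SchwartzMap.derivCLM ℂ ℂ f).integrable
  have := congrFun h x
  rwa [smul_eq_mul] at this

/-- For `sin θ = 0` the quadrature is already `cos θ · x`. Otherwise conjugation by `e^{i c x² / 2}`
with `c = cot θ` leaves `-i sin θ d/dx`, and the Fourier transform makes this multiplication by `2π
sin θ · x`. -/
theorem exists_diagonalizes (θ : ℝ) : ∃ V κ S, Diagonalizes θ V κ S := by
  by_cases hs : Real.sin θ = 0
  · refine ⟨LinearIsometryEquiv.refl ℂ H, Real.cos θ, id, ?_, Function.surjective_id,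
      fun f => rfl, fun f x => ?_⟩
    · intro hc
      have := Real.sin_sq_add_cos_sq θ
      simp [hs, hc] at this
    · rw [id, id, quadratureS_apply, hs]
      simp [mul_assoc]
  · set c : ℝ := Real.cos θ / Real.sin θ with hc
    let g : ℝ → ℝ → ℝ := fun c x => c * x ^ 2 / 2
    have hg : ∀ c, (g c).HasTemperateGrowth := fun c => by
      have : g c = fun x : ℝ => (c / 2) * x ^ 2 := by ext x; simp only [g]; ring
      rw [this]
      exact (Function.HasTemperateGrowth.const (c / 2)).mul
        (Function.HasTemperateGrowth.id'.pow 2)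
    let C : ℝ → 𝓢(ℝ, ℂ) → 𝓢(ℝ, ℂ) := fun c f =>
      SchwartzMap.smulLeftCLM ℂ (fun x => Complex.exp (Complex.I * g c x)) f
    have hC : ∀ c f x, C c f x = Complex.exp (Complex.I * g c x) * f x := fun c f x => by
      simp only [C]
      rw [SchwartzMap.smulLeftCLM_apply_apply (hasTemperateGrowth_cexp_I_mul (hg c)), smul_eq_mul]
    have hgm : Measurable (g c) := by fun_prop
    refine ⟨(phaseEquiv (g c) hgm).trans (Lp.fourierTransformₗᵢ ℝ ℂ), 2 * Real.pi * Real.sin θ,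
      fun f => FourierTransform.fourier (C c f), by positivity, fun f => ?_, fun f => ?_,
      fun f x => ?_⟩
    · refine ⟨C (-c) (FourierTransformInv.fourierInv f), ?_⟩
      have : C c (C (-c) (FourierTransformInv.fourierInv f)) = FourierTransformInv.fourierInv f := by
        ext x
        rw [hC, hC, ← mul_assoc, ← Complex.exp_add]
        simp [g, neg_div]
      simp only [this]
      simp
    · rw [LinearIsometryEquiv.trans_apply, phaseEquiv_schwartzEmb hgm (hC c f)]
      exact SchwartzMap.toLp_fourier_eq _
    · have h1 : C c (quadratureS θ f) =
          (-(Complex.I * Real.sin θ)) • SchwartzMap.derivCLM ℂ ℂ (C c f) := by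
        ext x
        have hd : HasDerivAt (fun x : ℝ => Complex.exp (Complex.I * g c x) * f x)
            (Complex.exp (Complex.I * g c x) * (Complex.I * ((c * (2 * x) / 2 : ℝ) : ℂ)) * f x +
              Complex.exp (Complex.I * g c x) * deriv f x) x := by
          have h0 : HasDerivAt (g c) (c * (2 * x) / 2) x := by
            simpa using ((hasDerivAt_pow 2 x).const_mul c).div_const 2
          exact ((h0.ofReal_comp.const_mul Complex.I).cexp).mul f.differentiableAt.hasDerivAt
        have he : (C c f : ℝ → ℂ) = fun x : ℝ => Complex.exp (Complex.I * g c x) * f x :=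
          funext (hC c f)
        rw [hC, quadratureS_apply, smul_apply, SchwartzMap.derivCLM_apply, he, hd.deriv,
          smul_eq_mul]
        have hsc : (Real.sin θ : ℂ) * c = Real.cos θ := by
          rw [hc, ← Complex.ofReal_mul, mul_div_cancel₀ _ hs]
        push_cast at hsc ⊢
        rw [← hsc]
        linear_combination (Complex.exp (Complex.I * g c x) * Complex.sin θ * c * x * f x) *
          Complex.I_sq
      simp only [h1]
      rw [FourierTransform.fourier_smul, smul_apply, fourier_derivCLM, smul_eq_mul]
      push_cast
      linear_combination (-2 * Real.pi * Complex.sin θ * x *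
        FourierTransform.fourier (C c f) x) * Complex.I_sq

/-! ### Weyl operators -/

theorem translation_coeFn (q : ℝ) (f : H) : translation q f =ᵐ[volume] fun x => f (x - q) :=
  Lp.coeFn_compMeasurePreserving f (measurePreserving_sub_right volume q)

theorem modulation_coeFn (p : ℝ) (f : H) :
    modulation p f =ᵐ[volume] fun x : ℝ => Complex.exp (Complex.I * (p * x)) * f x :=
  (memLp_modulation p f).coeFn_toLp

/-- Modulation acts before translation, so its phase is `p (x - q)`; the prefactor `q p / 2` makes
it `p x - q p / 2`. With this symmetric phase, `weyl (-q) (-p)` is exactly the inverse. -/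
theorem weyl_coeFn (q p : ℝ) (f : H) : weyl q p f =ᵐ[volume]
    fun x : ℝ => Complex.exp (Complex.I * ((p * x - q * p / 2 : ℝ) : ℂ)) * f (x - q) := by
  have h := (measurePreserving_sub_right volume q).quasiMeasurePreserving.ae_eq_comp
    (modulation_coeFn p f)
  filter_upwards [Lp.coeFn_smul (Complex.exp (Complex.I * (q * p / 2)))
    (translation q (modulation p f)), translation_coeFn q (modulation p f), h] with x h1 h2 h3
  simp only [Function.comp_apply] at h3
  change (Complex.exp (Complex.I * (q * p / 2)) • translation q (modulation p f) : H) x = _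
  rw [h1, Pi.smul_apply, h2, h3, smul_eq_mul, ← mul_assoc, ← Complex.exp_add]
  congr 2
  push_cast
  ring

theorem weyl_zero : weyl 0 0 = 1 := by
  ext1 f
  ext1
  filter_upwards [weyl_coeFn 0 0 f] with x hx
  simpa using hx

theorem weyl_neg_weyl (q p : ℝ) (f : H) : weyl (-q) (-p) (weyl q p f) = f := by
  ext1
  have h := (measurePreserving_sub_right volume (-q)).quasiMeasurePreserving.ae_eq_comp
    (weyl_coeFn q p f)
  filter_upwards [weyl_coeFn (-q) (-p) (weyl q p f), h] with x h1 h2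
  simp only [Function.comp_apply] at h2
  rw [h1, h2, ← mul_assoc, ← Complex.exp_add, ← mul_add, ← Complex.ofReal_add]
  have : -p * x - -q * -p / 2 + (p * (x - -q) - q * p / 2) = 0 := by ring
  rw [this]
  simp

theorem norm_weyl_le (q p : ℝ) (f : H) : ‖weyl q p f‖ ≤ ‖f‖ := by
  have h : ‖modulation p f‖ ≤ ‖f‖ := by
    refine Lp.norm_le_norm_of_ae_le ?_
    filter_upwards [modulation_coeFn p f] with x hx
    rw [hx, norm_mul, ← Complex.ofReal_mul, norm_cexp_I_mul, one_mul]
  have h2 : ‖translation q (modulation p f)‖ = ‖modulation p f‖ :=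
    (Lp.compMeasurePreservingₗᵢ ℂ (fun x : ℝ => x - q)
      (measurePreserving_sub_right volume q)).norm_map _
  have h3 : ‖Complex.exp (Complex.I * (q * p / 2))‖ = 1 := by
    have := norm_cexp_I_mul (q * p / 2)
    push_cast at this
    exact this
  change ‖Complex.exp (Complex.I * (q * p / 2)) • translation q (modulation p f)‖ ≤ _
  rw [norm_smul, h3, one_mul, h2]
  exact h

theorem norm_weyl (q p : ℝ) (f : H) : ‖weyl q p f‖ = ‖f‖ := by
  refine le_antisymm (norm_weyl_le q p f) ?_
  have := norm_weyl_le (-q) (-p) (weyl q p f)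
  rwa [weyl_neg_weyl] at this

theorem adjoint_weyl_comp_weyl (q p : ℝ) :
    ContinuousLinearMap.adjoint (weyl q p) ∘L weyl q p = 1 :=
  (ContinuousLinearMap.norm_map_iff_adjoint_comp_self _).1 (norm_weyl q p)

theorem weyl_weyl_neg (q p : ℝ) (f : H) : weyl q p (weyl (-q) (-p) f) = f := by
  have := weyl_neg_weyl (-q) (-p) f
  rwa [neg_neg, neg_neg] at this

theorem adjoint_weyl (q p : ℝ) : ContinuousLinearMap.adjoint (weyl q p) = weyl (-q) (-p) := by
  ext1 f
  nth_rewrite 1 [← weyl_weyl_neg q p f]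
  exact DFunLike.congr_fun (adjoint_weyl_comp_weyl q p) _

theorem weyl_comp_adjoint_weyl (q p : ℝ) :
    weyl q p ∘L ContinuousLinearMap.adjoint (weyl q p) = 1 := by
  ext1 f
  rw [adjoint_weyl]
  exact weyl_weyl_neg q p f

theorem inner_weyl_weyl (q p : ℝ) (φ ψ : H) : ⟪weyl q p φ, weyl q p ψ⟫_ℂ = ⟪φ, ψ⟫_ℂ := by
  rw [← ContinuousLinearMap.adjoint_inner_right]
  exact congrArg _ (DFunLike.congr_fun (adjoint_weyl_comp_weyl q p) ψ)

/-! ### Weyl covariance of the quadratures -/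

/-- Translation by `q` shifts the position part by `q cos θ` and modulation by `p` shifts the
momentum part by `p sin θ`. Both preserve Schwartz functions, so the shift can be computed
pointwise. -/
theorem exists_schwartz_weyl (θ q p : ℝ) (f : 𝓢(ℝ, ℂ)) :
    ∃ g : 𝓢(ℝ, ℂ), schwartzEmb g = weyl q p (schwartzEmb f) ∧
      schwartzEmb (quadratureS θ g) = weyl q p (schwartzEmb (quadratureS θ f)) +
        ((q * Real.cos θ + p * Real.sin θ : ℝ) : ℂ) • weyl q p (schwartzEmb f) := by
  have ht : (fun x : ℝ => x - q).HasTemperateGrowth :=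
    Function.HasTemperateGrowth.id'.sub (Function.HasTemperateGrowth.const q)
  have hl : AntilipschitzWith 1 fun x : ℝ => x - q :=
    AntilipschitzWith.of_le_mul_dist fun x y => by simp
  let k : ℝ → ℝ := fun x => p * x - q * p / 2
  have hk : k.HasTemperateGrowth :=
    ((Function.HasTemperateGrowth.const p).mul Function.HasTemperateGrowth.id').sub
      (Function.HasTemperateGrowth.const (q * p / 2))
  let g : 𝓢(ℝ, ℂ) := SchwartzMap.smulLeftCLM ℂ (fun x => Complex.exp (Complex.I * k x))
    (SchwartzMap.compCLMOfAntilipschitz ℂ ht hl f)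
  have hg : ∀ x, g x = Complex.exp (Complex.I * k x) * f (x - q) := fun x => by
    simp only [g]
    rw [SchwartzMap.smulLeftCLM_apply_apply (hasTemperateGrowth_cexp_I_mul hk), smul_eq_mul]
    rfl
  have hemb : ∀ f : 𝓢(ℝ, ℂ), weyl q p (schwartzEmb f) =ᵐ[volume]
      fun x => Complex.exp (Complex.I * k x) * f (x - q) := fun f => by
    have h := (measurePreserving_sub_right volume q).quasiMeasurePreserving.ae_eq_comp
      (schwartzEmb_coeFn f)
    filter_upwards [weyl_coeFn q p (schwartzEmb f), h] with x h1 h2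
    simp only [Function.comp_apply] at h2
    rw [h1, h2]
  have hd : ∀ x, deriv g x = Complex.exp (Complex.I * k x) * (Complex.I * (p : ℂ)) * f (x - q) +
      Complex.exp (Complex.I * k x) * deriv f (x - q) := fun x => by
    have h0 : HasDerivAt k p x := by
      simpa [k] using ((hasDerivAt_id x).const_mul p).sub_const (q * p / 2)
    have h1 : HasDerivAt (fun x => f (x - q)) (deriv f (x - q)) x :=
      (f.hasDerivAt (x - q)).comp_sub_const x q
    have h2 := (h0.ofReal_comp.const_mul Complex.I).cexp.mul h1
    rw [show (g : ℝ → ℂ) = fun x => Complex.exp (Complex.I * k x) * f (x - q) from funext hg]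
    exact h2.deriv
  refine ⟨g, ?_, ?_⟩
  · ext1
    filter_upwards [schwartzEmb_coeFn g, hemb f] with x h1 h2
    rw [h1, h2, hg]
  · ext1
    set s : ℂ := ((q * Real.cos θ + p * Real.sin θ : ℝ) : ℂ) with hs
    filter_upwards [schwartzEmb_coeFn (quadratureS θ g), hemb f, hemb (quadratureS θ f),
      Lp.coeFn_add (weyl q p (schwartzEmb (quadratureS θ f))) (s • weyl q p (schwartzEmb f)),
      Lp.coeFn_smul s (weyl q p (schwartzEmb f))] with x h1 h2 h3 h4 h5
    rw [h1, h4, Pi.add_apply, h5, Pi.smul_apply, h2, h3, quadratureS_apply, quadratureS_apply, hg,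
      hd, smul_eq_mul, hs]
    push_cast
    linear_combination (-Complex.sin θ * p * Complex.exp (Complex.I * k x) * f (x - q)) *
      Complex.I_sq

theorem graph_quadrature_eq_closure (θ : ℝ) :
    (quadrature θ).graph = (schwartzQuadrature θ).graph.topologicalClosure := by
  obtain ⟨V, κ, S, hV⟩ := exists_diagonalizes θ
  rw [quadrature_eq, hV.isClosable.graph_closure_eq_closure_graph]

theorem shear_mem_topologicalClosure {M : Type*} [NormedAddCommGroup M] [NormedSpace ℂ M]
    {N : Submodule ℂ (M × M)} (W : M →L[ℂ] M) (s : ℂ)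
    (h : ∀ z ∈ N, (W z.1, W z.2 + s • W z.1) ∈ N) {x y : M} (hz : (x, y) ∈ N.topologicalClosure) :
    (W x, W y + s • W x) ∈ N.topologicalClosure :=
  Set.MapsTo.closure (f := fun z : M × M => (W z.1, W z.2 + s • W z.1)) h (by fun_prop) hz

theorem weyl_mem_graph (θ q p : ℝ) {ψ η : H} (h : (ψ, η) ∈ (quadrature θ).graph) :
    (weyl q p ψ, weyl q p η + ((q * Real.cos θ + p * Real.sin θ : ℝ) : ℂ) • weyl q p ψ) ∈
      (quadrature θ).graph := by
  rw [graph_quadrature_eq_closure] at h ⊢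
  refine shear_mem_topologicalClosure _ _ (fun z hz => ?_) h
  obtain ⟨f, rfl⟩ := mem_graph_schwartzQuadrature.1 hz
  obtain ⟨g, h1, h2⟩ := exists_schwartz_weyl θ q p f
  exact mem_graph_schwartzQuadrature.2 ⟨g, Prod.ext h1.symm h2.symm⟩

theorem weyl_mem_domain_iff (θ q p : ℝ) (ψ : H) :
    weyl q p ψ ∈ (quadrature θ).domain ↔ ψ ∈ (quadrature θ).domain := by
  simp only [LinearPMap.mem_domain_iff]
  constructor
  · rintro ⟨η, hη⟩
    have := weyl_mem_graph θ (-q) (-p) hη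
    rw [weyl_neg_weyl] at this
    exact ⟨_, this⟩
  · rintro ⟨η, hη⟩
    exact ⟨_, weyl_mem_graph θ q p hη⟩

/-- With `s = q cos θ + p sin θ`, the translate `E(A + s)` belongs to `Q_θ - s`, and conjugation by
the Weyl operator brings this back to `Q_θ`. Uniqueness then turns the operator identity into
covariance of `E`. -/
theorem isSpectralMeasure_weyl {θ : ℝ} {E : Observable H ℝ}
    (hE : E.IsSpectralMeasure (quadrature θ)) (q p : ℝ) :
    ((E.map (fun x => x - (q * Real.cos θ + p * Real.sin θ)) (by fun_prop)).conj (weyl q p)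
      (adjoint_weyl_comp_weyl q p)).IsSpectralMeasure (quadrature θ) where
  isProjectionValued := (hE.isProjectionValued.map _).conj _ _ (weyl_comp_adjoint_weyl q p)
  mem_domain_iff ψ := by
    rw [Observable.measure_conj, Observable.measure_map,
      integrable_map_measure (by fun_prop) (by fun_prop), ← weyl_mem_domain_iff θ q p,
      hE.mem_domain_iff]
    set s := q * Real.cos θ + p * Real.sin θ
    set μ := E.measure (weyl q p ψ)
    rw [← memLp_two_iff_integrable_sq (f := fun x : ℝ => x) (by fun_prop)]
    change _ ↔ Integrable (fun x : ℝ => (x - s) ^ 2) μ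
    rw [← memLp_two_iff_integrable_sq (f := fun x : ℝ => x - s) (by fun_prop)]
    refine ⟨fun h => h.sub (memLp_const s), fun h => ?_⟩
    simpa [Pi.add_def] using h.add (memLp_const s)
  inner_eq ψ := by
    have hg := weyl_mem_graph θ q p ((quadrature θ).mem_graph ψ)
    have h1 := hE.inner_eq_of_mem_graph hg
    rw [inner_add_right, inner_smul_right, inner_weyl_weyl, inner_weyl_weyl] at h1
    rw [Observable.measure_conj, Observable.measure_map, integral_map (by fun_prop) (by fun_prop),
      integral_sub (hE.integrable_id hg) (integrable_const _), Complex.ofReal_sub, ← h1,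
      integral_const, Observable.measureReal_univ, norm_weyl, inner_self_eq_norm_sq_to_K]
    push_cast
    simp
    ring

/-- Weyl covariance of the spectral measure of a quadrature. -/
theorem adjoint_weyl_effect_weyl {θ : ℝ} {E : Observable H ℝ}
    (hE : E.IsSpectralMeasure (quadrature θ)) (q p : ℝ) {A : Set ℝ} (hA : MeasurableSet A) :
    ContinuousLinearMap.adjoint (weyl q p) ∘L
      E.effect ((fun x => x - (q * Real.cos θ + p * Real.sin θ)) ⁻¹' A) ∘L weyl q p =
        E.effect A := by
  have h := congrArg (fun F : Observable H ℝ => F.effect A)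
    ((isSpectralMeasure_weyl hE q p).unique hE)
  simp only [Observable.conj_effect, Observable.map_effect _ _ hA] at h
  exact h

/-! ### Weyl operators and the beam splitter -/

/-- The two-mode Weyl operator `W(a, b) ⊗ W(c, d)`. -/
def weyl₂ (a b c d : ℝ) : H₂ →L[ℂ] H₂ :=
  phaseOp (fun z : ℝ × ℝ => b * z.1 + d * z.2 - (a * b + c * d) / 2) (by fun_prop) ∘L
    (Lp.compMeasurePreservingₗᵢ ℂ (fun z : ℝ × ℝ => z - (a, c))
      (measurePreserving_sub_right volume (a, c))).toContinuousLinearMap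

theorem weyl₂_coeFn (a b c d : ℝ) (Ψ : H₂) : weyl₂ a b c d Ψ =ᵐ[volume] fun z : ℝ × ℝ =>
    Complex.exp (Complex.I * ((b * z.1 + d * z.2 - (a * b + c * d) / 2 : ℝ) : ℂ)) *
      Ψ (z - (a, c)) := by
  refine (phaseOp_coeFn (g := fun z : ℝ × ℝ => b * z.1 + d * z.2 - (a * b + c * d) / 2)
    (by fun_prop) _).trans ?_
  filter_upwards [Lp.coeFn_compMeasurePreserving Ψ
    (measurePreserving_sub_right volume ((a, c) : ℝ × ℝ))] with z hz
  exact congrArg _ hz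

theorem tensorOp_weyl (a b c d : ℝ) : tensorOp (weyl a b) (weyl c d) = weyl₂ a b c d := by
  refine clm_ext_tprod fun f g => ?_
  rw [tensorOp_tprod]
  ext1
  have h := (measurePreserving_sub_right volume ((a, c) : ℝ × ℝ)).quasiMeasurePreserving.ae_eq_comp
    (tprod_coeFn f g)
  filter_upwards [tprod_coeFn (weyl a b f) (weyl c d g), ae_fst (weyl_coeFn a b f),
    ae_snd (weyl_coeFn c d g), weyl₂_coeFn a b c d (tprod f g), h] with z h1 h2 h3 h4 h5
  simp only [Function.comp_apply] at h5
  rw [h1, h2, h3, h4, h5, mul_mul_mul_comm, ← Complex.exp_add]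
  congr 2
  push_cast
  ring

theorem beamSplitter_coeFn (Ψ : H₂) : beamSplitter Ψ =ᵐ[volume] fun z => Ψ (rot z) :=
  Lp.coeFn_compMeasurePreserving Ψ measurePreserving_rot

/-- The linear map `rot` sends `(q/√2, q/√2)` to `(q, 0)`, and the first coordinate of `rot z` is
`(z.1 + z.2)/√2`. Thus translation and modulation both split evenly, and the two central phases add
up to `q p / 2`. -/
theorem beamSplitter_weyl (q p : ℝ) (Ψ : H₂) :
    beamSplitter (tensorOp (weyl q p) 1 Ψ) =
      tensorOp (weyl (q / Real.sqrt 2) (p / Real.sqrt 2))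
        (weyl (q / Real.sqrt 2) (p / Real.sqrt 2)) (beamSplitter Ψ) := by
  rw [← weyl_zero, tensorOp_weyl, tensorOp_weyl]
  set v : ℝ × ℝ := (q / Real.sqrt 2, q / Real.sqrt 2) with hv
  have h1 := measurePreserving_rot.quasiMeasurePreserving.ae_eq_comp (weyl₂_coeFn q p 0 0 Ψ)
  have h2 := (measurePreserving_sub_right volume v).quasiMeasurePreserving.ae_eq_comp
    (beamSplitter_coeFn Ψ)
  ext1
  filter_upwards [beamSplitter_coeFn (weyl₂ q p 0 0 Ψ), h1, h2,
    weyl₂_coeFn (q / Real.sqrt 2) (p / Real.sqrt 2) (q / Real.sqrt 2) (p / Real.sqrt 2)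
      (beamSplitter Ψ)] with z e1 e2 e3 e4
  simp only [Function.comp_apply] at e2 e3
  rw [e1, e2, e4, e3]
  have h : Real.sqrt 2 * Real.sqrt 2 = 2 := Real.mul_self_sqrt (by norm_num)
  have h' : Real.sqrt 2 ≠ 0 := by positivity
  have hr : rot (z - v) = rot z - (q, 0) := by
    rw [map_sub, hv, rot_apply (q / Real.sqrt 2)]
    have e1 : (Real.sqrt 2)⁻¹ * (q / Real.sqrt 2 + q / Real.sqrt 2) = q := by
      field_simp
      linear_combination -q * h
    have e2 : (Real.sqrt 2)⁻¹ * (-(q / Real.sqrt 2) + q / Real.sqrt 2) = 0 := by ring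
    rw [e1, e2]
  have hp : (rot z).1 = (Real.sqrt 2)⁻¹ * (z.1 + z.2) := rfl
  rw [hr]
  congr 4
  rw [hp]
  field_simp
  linear_combination (-q * p) * h

/-! ### Traces -/

section Trace

variable {ι κ K L : Type*} [NormedAddCommGroup K] [InnerProductSpace ℂ K]
  [NormedAddCommGroup L] [InnerProductSpace ℂ L]

theorem hasSum_norm_inner_sq (f : HilbertBasis κ ℂ L) (x : L) :
    HasSum (fun j => ‖⟪f j, x⟫_ℂ‖ ^ 2) (‖x‖ ^ 2) := by
  have h := f.hasSum_inner_mul_inner x x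
  rw [inner_self_eq_norm_sq_to_K] at h
  refine Complex.hasSum_ofReal.1 ?_
  push_cast
  refine h.congr_fun fun j => ?_
  rw [← inner_conj_symm, Complex.norm_conj, Complex.mul_conj']

theorem summable_norm_inner_sq (e : HilbertBasis ι ℂ K) (f : HilbertBasis κ ℂ L) {A : K →L[ℂ] L}
    (hA : Summable fun i => ‖A (e i)‖ ^ 2) :
    Summable fun z : ι × κ => ‖⟪f z.2, A (e z.1)⟫_ℂ‖ ^ 2 := by
  refine (summable_prod_of_nonneg ?_).2 ⟨fun i => (hasSum_norm_inner_sq f (A (e i))).summable, ?_⟩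
  · intro z
    positivity
  · exact hA.congr fun i => (hasSum_norm_inner_sq f (A (e i))).tsum_eq.symm

variable [CompleteSpace K] [CompleteSpace L]

/-- Cyclicity of the trace for Hilbert–Schmidt operators. -/
theorem tsum_inner_eq_tsum_inner_adjoint (e : HilbertBasis ι ℂ K) (f : HilbertBasis κ ℂ L)
    {A B : L →L[ℂ] K} (hA : Summable fun i => ‖ContinuousLinearMap.adjoint A (e i)‖ ^ 2)
    (hB : Summable fun i => ‖ContinuousLinearMap.adjoint B (e i)‖ ^ 2) :
    ∑' j, ⟪A (f j), B (f j)⟫_ℂ =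
      ∑' i, ⟪ContinuousLinearMap.adjoint B (e i), ContinuousLinearMap.adjoint A (e i)⟫_ℂ := by
  -- Both traces are iterated sums of this double series, by Parseval in one basis or the other; the
  -- Hilbert–Schmidt bounds make it absolutely summable.
  let F : ι × κ → ℂ := fun z => ⟪ContinuousLinearMap.adjoint B (e z.1), f z.2⟫_ℂ *
    ⟪f z.2, ContinuousLinearMap.adjoint A (e z.1)⟫_ℂ
  have hF : Summable F := by
    refine Summable.of_norm_bounded
      ((summable_norm_inner_sq e f hA).add (summable_norm_inner_sq e f hB)) fun z => ?_
    rw [norm_mul, norm_inner_symm]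
    nlinarith [sq_nonneg (‖⟪f z.2, ContinuousLinearMap.adjoint B (e z.1)⟫_ℂ‖ -
      ‖⟪f z.2, ContinuousLinearMap.adjoint A (e z.1)⟫_ℂ‖),
      sq_nonneg ‖⟪f z.2, ContinuousLinearMap.adjoint B (e z.1)⟫_ℂ‖,
      sq_nonneg ‖⟪f z.2, ContinuousLinearMap.adjoint A (e z.1)⟫_ℂ‖]
  have h1 : ∀ i, ∑' j, F (i, j) =
      ⟪ContinuousLinearMap.adjoint B (e i), ContinuousLinearMap.adjoint A (e i)⟫_ℂ := fun i =>
    f.tsum_inner_mul_inner (ContinuousLinearMap.adjoint B (e i)) (ContinuousLinearMap.adjoint A (e i))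
  have h2 : ∀ j, ∑' i, F (i, j) = ⟪A (f j), B (f j)⟫_ℂ := fun j => by
    rw [← e.tsum_inner_mul_inner]
    refine tsum_congr fun i => ?_
    simp only [F, ContinuousLinearMap.adjoint_inner_left, ContinuousLinearMap.adjoint_inner_right]
    ring
  calc ∑' j, ⟪A (f j), B (f j)⟫_ℂ = ∑' j, ∑' i, F (i, j) := by simp only [h2]
    _ = ∑' i, ∑' j, F (i, j) := (Summable.tsum_comm (f := fun i j => F (i, j)) hF)
    _ = _ := by simp only [h1]

/-- Cyclicity applied to `A` and `A ∘L B`, both Hilbert–Schmidt. It replaces the fixed basis in `tr`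
by any basis of the target, so a product basis can be used on `L²(ℝ²)`. -/
theorem tr_adjoint_comp_self_comp {M : Type*} [NormedAddCommGroup M] [InnerProductSpace ℂ M]
    [CompleteSpace M] (e : HilbertBasis ι ℂ M) (A : K →L[ℂ] M)
    (hA : Summable fun i => ‖ContinuousLinearMap.adjoint A (e i)‖ ^ 2) (B : K →L[ℂ] K) :
    tr ((ContinuousLinearMap.adjoint A ∘L A) ∘L B) =
      ∑' i, ⟪ContinuousLinearMap.adjoint A (e i), B (ContinuousLinearMap.adjoint A (e i))⟫_ℂ := by
  have hB : Summable fun i => ‖ContinuousLinearMap.adjoint (A ∘L B) (e i)‖ ^ 2 := by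
    refine Summable.of_nonneg_of_le (fun i => by positivity) (fun i => ?_)
      (hA.mul_left (‖ContinuousLinearMap.adjoint B‖ ^ 2))
    rw [ContinuousLinearMap.adjoint_comp, ← mul_pow]
    gcongr
    exact (ContinuousLinearMap.adjoint B).le_opNorm _
  have h := tsum_inner_eq_tsum_inner_adjoint e (onb K) hA hB
  simp only [ContinuousLinearMap.adjoint_comp, ContinuousLinearMap.comp_apply,
    ContinuousLinearMap.adjoint_inner_left B] at h
  rw [tr, ← h]
  refine tsum_congr fun i => ?_
  simp [ContinuousLinearMap.adjoint_inner_right]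

/-- `R = √ρ` satisfies `‖R e_i‖² = ⟨e_i, ρ e_i⟩`, so trace one makes it Hilbert–Schmidt with unit
norm. -/
theorem IsState.exists_sqrt {ρ : K →L[ℂ] K} (h : IsState ρ) :
    ∃ R : K →L[ℂ] K, ContinuousLinearMap.adjoint R = R ∧ R ∘L R = ρ ∧
      HasSum (fun i => ‖R (onb K i)‖ ^ 2) 1 := by
  have h0 : (0 : K →L[ℂ] K) ≤ ρ := (ContinuousLinearMap.nonneg_iff_isPositive ρ).2 h.isPositive
  have h1 : ContinuousLinearMap.adjoint (CFC.sqrt ρ) = CFC.sqrt ρ :=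
    (IsSelfAdjoint.of_nonneg (CFC.sqrt_nonneg ρ)).star_eq
  have h2 : CFC.sqrt ρ ∘L CFC.sqrt ρ = ρ := CFC.sqrt_mul_sqrt_self ρ h0
  refine ⟨CFC.sqrt ρ, h1, h2, Complex.hasSum_ofReal.1 ?_⟩
  refine h.hasSum_one.congr_fun fun i => ?_
  conv_rhs => rw [← h2]
  rw [ContinuousLinearMap.comp_apply, ← ContinuousLinearMap.adjoint_inner_left, h1,
    inner_self_eq_norm_sq_to_K]
  push_cast
  rfl

theorem isState_rankOne {ψ : K} (h : ‖ψ‖ = 1) : IsState (InnerProductSpace.rankOne ℂ ψ ψ) where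
  isPositive := InnerProductSpace.isPositive_rankOne_self ψ
  hasSum_one := by
    have h1 := (onb K).hasSum_inner_mul_inner ψ ψ
    rw [inner_self_eq_norm_sq_to_K, h] at h1
    simpa [inner_smul_right] using h1

theorem tr_rankOne_comp (ψ : K) (B : K →L[ℂ] K) :
    tr (InnerProductSpace.rankOne ℂ ψ ψ ∘L B) = ⟪ψ, B ψ⟫_ℂ := by
  have h := (onb K).tsum_inner_mul_inner (ContinuousLinearMap.adjoint B ψ) ψ
  rw [ContinuousLinearMap.adjoint_inner_left] at h
  rw [← h, tr]
  refine tsum_congr fun i => ?_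
  simp [ContinuousLinearMap.adjoint_inner_left]

/-- Bounded operators are determined by their expectation values in the states. -/
theorem eq_of_forall_tr_eq {B C : K →L[ℂ] K}
    (h : ∀ ρ : K →L[ℂ] K, IsState ρ → tr (ρ ∘L B) = tr (ρ ∘L C)) : B = C := by
  refine clm_ext_of_inner_self fun ψ => ?_
  rcases eq_or_ne ψ 0 with rfl | hψ
  · simp
  have h1 := h _ (isState_rankOne (norm_smul_inv_norm (𝕜 := ℂ) hψ))
  rw [tr_rankOne_comp, tr_rankOne_comp] at h1
  simp only [map_smul, inner_smul_left, inner_smul_right] at h1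
  have h2 : ((‖ψ‖ : ℂ)⁻¹) ≠ 0 := inv_ne_zero (Complex.ofReal_ne_zero.2 (norm_ne_zero_iff.2 hψ))
  exact mul_left_cancel₀ ((map_ne_zero (starRingEnd ℂ)).2 h2) (mul_left_cancel₀ h2 h1)

end Trace

/-! ### The measured observable -/

/-- If `V` and `V'` diagonalize the two quadratures, `V ⊗ V'` diagonalizes both at once, and the
joint observable is the indicator of `(κ x, κ' y) ∈ Z` in that picture. -/
theorem exists_joint_observable (θ : ℝ) : ∃ (Q Qθ : Observable H ℝ) (G : Observable H₂ (ℝ × ℝ)),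
    Q.IsSpectralMeasure (quadrature 0) ∧ Qθ.IsSpectralMeasure (quadrature θ) ∧
      ∀ A B, MeasurableSet A → MeasurableSet B →
        G.effect (A ×ˢ B) = tensorOp (Q.effect A) (Qθ.effect B) := by
  obtain ⟨V, κ, S, hV⟩ := exists_diagonalizes 0
  obtain ⟨V', κ', S', hV'⟩ := exists_diagonalizes θ
  have hU : ContinuousLinearMap.adjoint (tensorOp (V : H →L[ℂ] H) (V' : H →L[ℂ] H)) ∘L
      tensorOp (V : H →L[ℂ] H) (V' : H →L[ℂ] H) = 1 := by
    rw [tensorOp_adjoint, tensorOp_comp, adjoint_comp_self, adjoint_comp_self, tensorOp_one]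
  have hf : Measurable fun z : ℝ × ℝ => (κ * z.1, κ' * z.2) := by fun_prop
  refine ⟨diagonalObservable V κ, diagonalObservable V' κ',
    ((canonicalObservable volume).map _ hf).conj _ hU, hV.isSpectralMeasure,
    hV'.isSpectralMeasure, fun A B hA hB => ?_⟩
  rw [Observable.conj_effect, Observable.map_effect _ hf (hA.prod hB), diagonalObservable,
    diagonalObservable, Observable.conj_effect, Observable.conj_effect,
    Observable.map_effect _ _ hA, Observable.map_effect _ _ hB, ← tensorOp_comp, ← tensorOp_comp,
    ← tensorOp_adjoint, tensorOp_canonicalObservable (measurable_const_mul κ hA)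
      (measurable_const_mul κ' hB)]
  rfl

/-- The map `φ ↦ U (φ ⊗ χ)`. -/
def beamSplitterLeft (χ : H) : H →L[ℂ] H₂ := beamSplitter ∘L tprodLeft χ

theorem beamSplitterLeft_apply (φ χ : H) : beamSplitterLeft χ φ = beamSplitter (tprod φ χ) := rfl

theorem norm_beamSplitter (Ψ : H₂) : ‖beamSplitter Ψ‖ = ‖Ψ‖ :=
  (Lp.compMeasurePreservingₗᵢ ℂ rot measurePreserving_rot).norm_map Ψ

theorem norm_beamSplitterLeft_apply (φ χ : H) : ‖beamSplitterLeft χ φ‖ = ‖φ‖ * ‖χ‖ := by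
  rw [beamSplitterLeft_apply, norm_beamSplitter, norm_tprod]

theorem norm_beamSplitterLeft_le (χ : H) : ‖beamSplitterLeft χ‖ ≤ ‖χ‖ :=
  ContinuousLinearMap.opNorm_le_bound _ (norm_nonneg _) fun φ => by
    rw [norm_beamSplitterLeft_apply, mul_comm]

theorem image_div_sqrt_two (X : Set ℝ) :
    (fun x => x / Real.sqrt 2) '' X = (fun x => Real.sqrt 2 * x) ⁻¹' X := by
  have h' : Real.sqrt 2 ≠ 0 := by positivity
  ext x
  constructor
  · rintro ⟨y, hy, rfl⟩
    simpa [mul_div_cancel₀ _ h'] using hy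
  · intro hx
    exact ⟨_, hx, mul_div_cancel_left₀ x h'⟩

theorem measurableSet_image_div_sqrt_two {X : Set ℝ} (hX : MeasurableSet X) :
    MeasurableSet ((fun x => x / Real.sqrt 2) '' X) := by
  rw [image_div_sqrt_two]
  exact measurable_const_mul _ hX

/-- The observable `E` is obtained from `Q ⊗ Qθ` by the beam splitter, when the second mode is in
the state `S²`. -/
def IsMeasured (Q Qθ : Observable H ℝ) (S : H →L[ℂ] H) (E : Observable H (ℝ × ℝ)) : Prop :=
  ∀ X Y, MeasurableSet X → MeasurableSet Y → ∀ φ,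
    HasSum (fun k => ⟪beamSplitterLeft (S (onb H k)) φ,
      tensorOp (Q.effect ((fun x => x / Real.sqrt 2) '' X))
        (Qθ.effect ((fun y => y / Real.sqrt 2) '' Y)) (beamSplitterLeft (S (onb H k)) φ)⟫_ℂ)
      ⟪φ, E.effect (X ×ˢ Y) φ⟫_ℂ

/-- The maps `φ ↦ U (φ ⊗ S e_k)` have squared norms `‖φ‖² ‖S e_k‖²`, summing to `‖φ‖²`. They serve
as Kraus operators for the joint observable rescaled by `√2`. -/
theorem exists_isMeasured {Q Qθ : Observable H ℝ} {G : Observable H₂ (ℝ × ℝ)}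
    (hG : ∀ A B, MeasurableSet A → MeasurableSet B →
      G.effect (A ×ˢ B) = tensorOp (Q.effect A) (Qθ.effect B)) {S : H →L[ℂ] H}
    (hS : HasSum (fun k => ‖S (onb H k)‖ ^ 2) 1) : ∃ E, IsMeasured Q Qθ S E := by
  have hJs : Summable fun k => ‖beamSplitterLeft (S (onb H k))‖ ^ 2 :=
    Summable.of_nonneg_of_le (fun k => by positivity) (fun k => by
      gcongr; exact norm_beamSplitterLeft_le _) hS.summable
  have hJ : ∀ φ, HasSum (fun k => ‖beamSplitterLeft (S (onb H k)) φ‖ ^ 2) (‖φ‖ ^ 2) := fun φ => by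
    simpa only [norm_beamSplitterLeft_apply, mul_pow, mul_one] using hS.mul_left (‖φ‖ ^ 2)
  have hf : Measurable fun z : ℝ × ℝ => (Real.sqrt 2 * z.1, Real.sqrt 2 * z.2) := by fun_prop
  refine ⟨(G.map _ hf).dilate (fun k => beamSplitterLeft (S (onb H k))) hJs hJ,
    fun X Y hX hY φ => ?_⟩
  have h := Observable.hasSum_inner_dilate (G.map _ hf) _ hJs hJ (X ×ˢ Y) φ φ
  have h1 : (G.map _ hf).effect (X ×ˢ Y) = tensorOp (Q.effect ((fun x => x / Real.sqrt 2) '' X))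
      (Qθ.effect ((fun y => y / Real.sqrt 2) '' Y)) := by
    rw [Observable.map_effect _ hf (hX.prod hY),
      ← hG _ _ (measurableSet_image_div_sqrt_two hX) (measurableSet_image_div_sqrt_two hY),
      image_div_sqrt_two, image_div_sqrt_two]
    rfl
  rwa [h1] at h

theorem tr_comp_eq_tr_beamSplitter {ρ σ S : H →L[ℂ] H} (hρ : IsState ρ)
    (hSa : ContinuousLinearMap.adjoint S = S) (hSS : S ∘L S = σ)
    (hS : HasSum (fun k => ‖S (onb H k)‖ ^ 2) 1) {B : H →L[ℂ] H} {G : H₂ →L[ℂ] H₂}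
    (hB : ∀ φ, HasSum (fun k => ⟪beamSplitterLeft (S (onb H k)) φ,
      G (beamSplitterLeft (S (onb H k)) φ)⟫_ℂ) ⟪φ, B φ⟫_ℂ) :
    tr (ρ ∘L B) =
      tr ((beamSplitter ∘L tensorOp ρ σ ∘L ContinuousLinearMap.adjoint beamSplitter) ∘L G) := by
  obtain ⟨R, hRa, hRR, hR⟩ := hρ.exists_sqrt
  have h1 : tr (ρ ∘L B) = ∑' j, ⟪R (onb H j), B (R (onb H j))⟫_ℂ := by
    have h := tr_adjoint_comp_self_comp (onb H) R (by rw [hRa]; exact hR.summable) B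
    rwa [hRa, hRR] at h
  -- `U (ρ ⊗ σ) U* = A* A`, and `A*` sends `e_i ⊗ e_k` to `U (R e_i ⊗ S e_k)`. Summing first over
  -- `k` therefore produces `⟨R e_i, B R e_i⟩`.
  set A : H₂ →L[ℂ] H₂ := tensorOp R S ∘L ContinuousLinearMap.adjoint beamSplitter with hA
  have hAa : ContinuousLinearMap.adjoint A = beamSplitter ∘L tensorOp R S := by
    rw [hA, ContinuousLinearMap.adjoint_comp, ContinuousLinearMap.adjoint_adjoint,
      tensorOp_adjoint, hRa, hSa]
  have hAA : beamSplitter ∘L tensorOp ρ σ ∘L ContinuousLinearMap.adjoint beamSplitter =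
      ContinuousLinearMap.adjoint A ∘L A := by
    rw [hAa, hA, ← hRR, ← hSS, ← tensorOp_comp]
    rfl
  have hAe : ∀ z, ContinuousLinearMap.adjoint A (tensorBasis (onb H) (onb H) z) =
      beamSplitterLeft (S (onb H z.2)) (R (onb H z.1)) := fun z => by
    rw [hAa, tensorBasis_apply, ContinuousLinearMap.comp_apply, tensorOp_tprod,
      beamSplitterLeft_apply]
  have hsum := hR.summable.mul_of_nonneg hS.summable (fun _ => by positivity)
    (fun _ => by positivity)
  have h2 := tr_adjoint_comp_self_comp (tensorBasis (onb H) (onb H)) A (by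
    simpa only [hAe, norm_beamSplitterLeft_apply, mul_pow] using hsum) G
  rw [hAA, h2, h1]
  simp only [hAe]
  rw [Summable.tsum_prod]
  · exact tsum_congr fun j => (hB (R (onb H j))).tsum_eq.symm
  · refine Summable.of_norm_bounded (hsum.mul_left ‖G‖) fun z => ?_
    refine (norm_inner_le_norm _ _).trans ?_
    calc _ ≤ ‖beamSplitterLeft (S (onb H z.2)) (R (onb H z.1))‖ *
          (‖G‖ * ‖beamSplitterLeft (S (onb H z.2)) (R (onb H z.1))‖) := by
          gcongr; exact ContinuousLinearMap.le_opNorm _ _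
      _ = _ := by rw [norm_beamSplitterLeft_apply]; ring

theorem IsMeasured.isHighAmplitudeObservable {θ : ℝ} {σ S : H →L[ℂ] H} {Q Qθ : Observable H ℝ}
    {E : Observable H (ℝ × ℝ)} (hQ : Q.IsSpectralMeasure (quadrature 0))
    (hQθ : Qθ.IsSpectralMeasure (quadrature θ)) (hSa : ContinuousLinearMap.adjoint S = S)
    (hSS : S ∘L S = σ) (hS : HasSum (fun k => ‖S (onb H k)‖ ^ 2) 1) (hE : IsMeasured Q Qθ S E) :
    IsHighAmplitudeObservable θ σ E :=
  ⟨Q, Qθ, hQ, hQθ, fun _ hρ X Y hX hY =>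
    tr_comp_eq_tr_beamSplitter hρ hSa hSS hS (hE X Y hX hY)⟩

theorem IsHighAmplitudeObservable.unique {θ : ℝ} {σ : H →L[ℂ] H} {E F : Observable H (ℝ × ℝ)}
    (hE : IsHighAmplitudeObservable θ σ E) (hF : IsHighAmplitudeObservable θ σ F) : E = F := by
  obtain ⟨Q, Qθ, hQ, hQθ, hE⟩ := hE
  obtain ⟨Q', Qθ', hQ', hQθ', hF⟩ := hF
  obtain rfl := hQ.unique hQ'
  obtain rfl := hQθ.unique hQθ'
  exact Observable.ext_of_prod fun X Y hX hY => eq_of_forall_tr_eq fun ρ hρ =>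
    (hE ρ hρ X Y hX hY).trans (hF ρ hρ X Y hX hY).symm

/-! ### Covariance -/

theorem beamSplitterLeft_weyl (q p : ℝ) (φ χ : H) :
    beamSplitterLeft χ (weyl q p φ) = tensorOp (weyl (q / Real.sqrt 2) (p / Real.sqrt 2))
      (weyl (q / Real.sqrt 2) (p / Real.sqrt 2)) (beamSplitterLeft χ φ) := by
  have h := beamSplitter_weyl q p (tprod φ χ)
  rw [tensorOp_tprod] at h
  exact h

theorem image_div_preimage_sub (X : Set ℝ) (s : ℝ) :
    (fun x => x / Real.sqrt 2) '' ((fun x => x - s) ⁻¹' X) =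
      (fun x => x - s / Real.sqrt 2) ⁻¹' ((fun x => x / Real.sqrt 2) '' X) := by
  have h' : Real.sqrt 2 ≠ 0 := by positivity
  rw [image_div_sqrt_two, image_div_sqrt_two]
  ext x
  simp only [Set.mem_preimage, mul_sub, mul_div_cancel₀ _ h']

/-- On rectangles, moving `W(q, p)` through the beam splitter shifts the two quadratures by `q/√2`
and `s/√2`, exactly the rescaled shifts of `X` and `Y`. -/
theorem IsMeasured.adjoint_weyl_comp {θ : ℝ} {S : H →L[ℂ] H} {Q Qθ : Observable H ℝ}
    {E : Observable H (ℝ × ℝ)} (hQ : Q.IsSpectralMeasure (quadrature 0))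
    (hQθ : Qθ.IsSpectralMeasure (quadrature θ)) (hE : IsMeasured Q Qθ S E) (q p : ℝ)
    {Z : Set (ℝ × ℝ)} (hZ : MeasurableSet Z) :
    ContinuousLinearMap.adjoint (weyl q p) ∘L
      E.effect ((fun z => z - (q, q * Real.cos θ + p * Real.sin θ)) ⁻¹' Z) ∘L weyl q p =
        E.effect Z := by
  set s := q * Real.cos θ + p * Real.sin θ with hs
  have hf : Measurable fun z : ℝ × ℝ => z - (q, s) := by fun_prop
  suffices h : (E.map _ hf).conj (weyl q p) (adjoint_weyl_comp_weyl q p) = E by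
    have := congrArg (fun F : Observable H (ℝ × ℝ) => F.effect Z) h
    simpa only [Observable.conj_effect, Observable.map_effect _ hf hZ] using this
  refine Observable.ext_of_prod fun X Y hX hY => clm_ext_of_inner_self fun φ => ?_
  rw [Observable.conj_effect, Observable.map_effect _ hf (hX.prod hY)]
  have hpre : (fun z : ℝ × ℝ => z - (q, s)) ⁻¹' (X ×ˢ Y) =
      ((fun x => x - q) ⁻¹' X) ×ˢ ((fun y => y - s) ⁻¹' Y) := rfl
  rw [hpre, ContinuousLinearMap.comp_apply, ContinuousLinearMap.comp_apply,
    ContinuousLinearMap.adjoint_inner_right]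
  refine (hE _ _ (measurable_id.sub_const q hX) (measurable_id.sub_const s hY) _).unique ?_
  refine (hE X Y hX hY φ).congr_fun fun k => ?_
  simp only [id]
  rw [beamSplitterLeft_weyl, ← ContinuousLinearMap.adjoint_inner_right, tensorOp_adjoint,
    ← ContinuousLinearMap.comp_apply, ← ContinuousLinearMap.comp_apply, tensorOp_comp,
    tensorOp_comp, image_div_preimage_sub, image_div_preimage_sub]
  have h1 := adjoint_weyl_effect_weyl hQ (q / Real.sqrt 2) (p / Real.sqrt 2)
    (measurableSet_image_div_sqrt_two hX)
  have h2 := adjoint_weyl_effect_weyl hQθ (q / Real.sqrt 2) (p / Real.sqrt 2)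
    (measurableSet_image_div_sqrt_two hY)
  have e1 : q / Real.sqrt 2 * Real.cos 0 + p / Real.sqrt 2 * Real.sin 0 = q / Real.sqrt 2 := by
    simp
  have e2 : q / Real.sqrt 2 * Real.cos θ + p / Real.sqrt 2 * Real.sin θ = s / Real.sqrt 2 := by
    rw [hs]; ring
  rw [e1] at h1
  rw [e2] at h2
  rw [← ContinuousLinearMap.comp_assoc] at h1 h2
  rw [h1, h2]

theorem image_add_eq_preimage_sub {M : Type*} [AddCommGroup M] (v : M) (Z : Set M) :
    (fun z => z + v) '' Z = (fun z => z - v) ⁻¹' Z := by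
  simp [sub_eq_add_neg]

/-! ### Failure of translation invariance and the covariance criterion -/

theorem nontrivial_H : ∃ ψ : H, ψ ≠ 0 := by
  refine ⟨indicatorConstLp 2 (measurableSet_Icc (a := (0 : ℝ)) (b := 1)) (by simp) (1 : ℂ),
    fun h => ?_⟩
  have := norm_indicatorConstLp (μ := (volume : Measure ℝ)) (p := 2) (c := (1 : ℂ))
    (hs := measurableSet_Icc (a := (0 : ℝ)) (b := 1)) (hμs := by simp) (by simp) (by simp)
  rw [h] at this
  simp [Measure.real] at this

/-- An observable on the plane is not invariant under a nonzero vertical translation. -/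
theorem eq_zero_of_invariant {E : Observable H (ℝ × ℝ)} {t : ℝ}
    (h : ∀ Z, MeasurableSet Z → E.effect ((fun z => z - (0, t)) ⁻¹' Z) = E.effect Z) : t = 0 := by
  by_contra ht
  obtain ⟨ψ, hψ⟩ := nontrivial_H
  -- Dividing the second coordinate by `t` normalizes the period to one.
  let μ : Measure ℝ := (E.measure ψ).map fun z => z.2 / t
  have hm : Measurable fun z : ℝ × ℝ => z.2 / t := by fun_prop
  have hinv : ∀ A, MeasurableSet A → μ ((fun x => x - 1) ⁻¹' A) = μ A := fun A hA => by
    have hA' : MeasurableSet ((fun x : ℝ => x - 1) ⁻¹' A) := measurable_id.sub_const 1 hA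
    simp only [μ]
    rw [Measure.map_apply hm hA, Measure.map_apply hm hA', Observable.measure_apply _ _ (hm hA),
      Observable.measure_apply _ _ (hm hA'), ← h _ (hm hA)]
    congr 5
    ext z
    simp [sub_div, div_self ht]
  -- By invariance every `(-∞, n]` has the mass of `(-∞, 0]`, and below every `[1 - n, ∞)` has that
  -- of `[1, ∞)`. In the limit two disjoint half-lines each carry the full finite mass, which must
  -- vanish.
  have hIic : ∀ n : ℕ, μ (Set.Iic (n : ℝ)) = μ (Set.Iic 0) := fun n => by
    induction n with
    | zero => simp
    | succ n ih =>
      rw [← ih, ← hinv (Set.Iic (n : ℝ)) measurableSet_Iic]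
      congr 1
      ext x
      simp
  have hIci : ∀ n : ℕ, μ (Set.Ici (1 - (n : ℝ))) = μ (Set.Ici 1) := fun n => by
    induction n with
    | zero => simp
    | succ n ih =>
      rw [← ih, ← hinv _ measurableSet_Ici]
      congr 1
      ext x
      simp only [Set.mem_preimage, Set.mem_Ici]
      push_cast
      constructor <;> intro h <;> linarith
  have h1 : μ (Set.Iic 0) = μ Set.univ := by
    have h := (tendsto_measure_Iic_atTop μ).comp tendsto_natCast_atTop_atTop
    simp only [Function.comp_def, hIic] at h
    exact tendsto_nhds_unique tendsto_const_nhds h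
  have h2 : μ (Set.Ici 1) = μ Set.univ := by
    have h := (tendsto_measure_Ici_atBot μ).comp
      (Filter.tendsto_atBot_add_const_left _ (1 : ℝ)
        (Filter.tendsto_neg_atTop_atBot.comp tendsto_natCast_atTop_atTop))
    simp only [Function.comp_def, ← sub_eq_add_neg, hIci] at h
    exact tendsto_nhds_unique tendsto_const_nhds h
  have h3 : μ Set.univ + μ Set.univ ≤ μ Set.univ := by
    calc μ Set.univ + μ Set.univ = μ (Set.Iic 0) + μ (Set.Ici 1) := by rw [h1, h2]
      _ = μ (Set.Iic 0 ∪ Set.Ici 1) := (measure_union (Set.disjoint_left.2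
        fun x (hx : x ≤ 0) (hx' : 1 ≤ x) => by linarith) measurableSet_Ici).symm
      _ ≤ μ Set.univ := measure_mono (Set.subset_univ _)
  have h4 : μ Set.univ = ENNReal.ofReal (‖ψ‖ ^ 2) := by
    rw [Measure.map_apply hm MeasurableSet.univ, Set.preimage_univ, Observable.measure_univ]
  rw [h4, ← ENNReal.ofReal_add (by positivity) (by positivity),
    ENNReal.ofReal_le_ofReal_iff (by positivity)] at h3
  have : 0 < ‖ψ‖ ^ 2 := pow_pos (norm_pos_iff.2 hψ) 2
  linarith

theorem isCovariant_iff {θ : ℝ} {E : Observable H (ℝ × ℝ)}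
    (hE : ∀ (q p : ℝ) (Z : Set (ℝ × ℝ)), MeasurableSet Z →
      weyl q p ∘L E.effect Z ∘L ContinuousLinearMap.adjoint (weyl q p) =
        E.effect ((fun z => z + (q, q * Real.cos θ + p * Real.sin θ)) '' Z)) :
    IsCovariant E ↔ Real.sin θ = 1 := by
  constructor
  · intro hc
    have key : ∀ Z, MeasurableSet Z →
        E.effect ((fun z => z - (0, 1 - Real.sin θ)) ⁻¹' Z) = E.effect Z := fun Z hZ => by
      -- Displacing `Z` by `-sin θ` first cancels the shift from the general law at `(0, 1)`, while
      -- the covariant law leaves `1 - sin θ`.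
      have hZ' : MeasurableSet ((fun z : ℝ × ℝ => z - (0, -Real.sin θ)) ⁻¹' Z) :=
        measurable_id.sub_const _ hZ
      have h := (hc 0 1 _ hZ').symm.trans (hE 0 1 _ hZ')
      rw [image_add_eq_preimage_sub, image_add_eq_preimage_sub, Set.preimage_preimage,
        Set.preimage_preimage] at h
      convert h using 2
      · ext z
        simp only [Set.mem_preimage]
        rw [sub_sub]
        simp [sub_eq_add_neg]
      · ext z
        simp only [Set.mem_preimage]
        rw [sub_sub]
        simp [← Prod.zero_eq_mk]
    linarith [eq_zero_of_invariant key]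
  · intro hs q p Z hZ
    have hc : Real.cos θ = 0 := by
      have := Real.sin_sq_add_cos_sq θ
      rw [hs] at this
      have h2 : Real.cos θ ^ 2 = 0 := by linarith
      exact pow_eq_zero_iff two_ne_zero |>.1 h2
    rw [hE q p Z hZ, hs, hc, mul_zero, mul_one, zero_add]

theorem sin_eq_one_iff_exists (θ : ℝ) :
    Real.sin θ = 1 ↔ ∃ k : ℤ, θ = Real.pi / 2 + 2 * Real.pi * k := by
  rw [Real.sin_eq_one_iff]
  exact exists_congr fun k => by constructor <;> intro h <;> linarith

theorem sin_eq_one_iff_of_mem_Ioc {θ : ℝ} (h : θ ∈ Set.Ioc (-Real.pi) Real.pi) :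
    Real.sin θ = 1 ↔ θ = Real.pi / 2 := by
  constructor
  · intro hs
    obtain ⟨k, hk⟩ := (sin_eq_one_iff_exists θ).1 hs
    have hpi := Real.pi_pos
    have h1 : (-1 : ℝ) < k := by
      by_contra hc
      nlinarith [h.1]
    have h2 : (k : ℝ) < 1 := by
      by_contra hc
      nlinarith [h.2]
    have h3 : k = 0 := by
      have : (-1 : ℤ) < k := by exact_mod_cast h1
      have : k < 1 := by exact_mod_cast h2
      omega
    rw [hk, h3]
    simp
  · rintro rfl
    exact Real.sin_pi_div_two

end EightPort

end

/-! ### The theorem on the measured observable -/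

theorem mainTheorem2 (θ : ℝ) (σ : EightPort.H →L[ℂ] EightPort.H) (hσ : EightPort.IsState σ) :
    (∃! E : EightPort.Observable EightPort.H (ℝ × ℝ),
      EightPort.IsHighAmplitudeObservable θ σ E) ∧
    ∀ E : EightPort.Observable EightPort.H (ℝ × ℝ), EightPort.IsHighAmplitudeObservable θ σ E →
      (∀ (q p : ℝ) (Z : Set (ℝ × ℝ)), MeasurableSet Z →
        EightPort.weyl q p ∘L E.effect Z ∘L ContinuousLinearMap.adjoint (EightPort.weyl q p) =
          E.effect ((fun z => z + (q, q * Real.cos θ + p * Real.sin θ)) '' Z)) ∧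
      (EightPort.IsCovariant E ↔ ∃ k : ℤ, θ = Real.pi / 2 + 2 * Real.pi * k) ∧
      (θ ∈ Set.Ioc (-Real.pi) Real.pi → (EightPort.IsCovariant E ↔ θ = Real.pi / 2)) := by
  obtain ⟨S, hSa, hSS, hS⟩ := hσ.exists_sqrt
  obtain ⟨Q, Qθ, G, hQ, hQθ, hG⟩ := EightPort.exists_joint_observable θ
  obtain ⟨E₀, hE₀⟩ := EightPort.exists_isMeasured hG hS
  have hE₀' := hE₀.isHighAmplitudeObservable hQ hQθ hSa hSS hS
  refine ⟨⟨E₀, hE₀', fun F hF => hF.unique hE₀'⟩, fun E hE => ?_⟩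
  -- Every solution is the constructed one, so its explicit form `IsMeasured` is available for
  -- covariance.
  obtain rfl := hE.unique hE₀'
  have hcov : ∀ (q p : ℝ) (Z : Set (ℝ × ℝ)), MeasurableSet Z →
      EightPort.weyl q p ∘L E.effect Z ∘L ContinuousLinearMap.adjoint (EightPort.weyl q p) =
        E.effect ((fun z => z + (q, q * Real.cos θ + p * Real.sin θ)) '' Z) := fun q p Z hZ => by
    have h1 : ∀ φ, EightPort.weyl q p (ContinuousLinearMap.adjoint (EightPort.weyl q p) φ) = φ :=
      fun φ => DFunLike.congr_fun (EightPort.weyl_comp_adjoint_weyl q p) φ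
    rw [EightPort.image_add_eq_preimage_sub, ← hE₀.adjoint_weyl_comp hQ hQθ q p hZ]
    ext1 φ
    simp only [ContinuousLinearMap.comp_apply, h1]
  have hiff := EightPort.isCovariant_iff hcov
  exact ⟨hcov, hiff.trans (EightPort.sin_eq_one_iff_exists θ),
    fun h => hiff.trans (EightPort.sin_eq_one_iff_of_mem_Ioc h)⟩
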